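/- For a multi-index $\alpha\in\mathbb{Z}_{\ge 0}^n$ put $\alpha!=\prod_j\alpha_j!$, $|\alpha|=\sum_j\alpha_j$, $X^\alpha=\prod_j X_j^{\alpha_j}$, and let $\mathbf e_j$ be the $j$-th unit multi-index. An $n$-type tree is a finite planar rooted tree $\mathcal T$ together with a type $\tau(v)\in[n]=\{1,\dots,n\}$ for each vertex $v$; it is called ordered if siblings of smaller types always lie to the left of siblings of larger types. For an internal (non-leaf) vertex $v$ let $\mu(v)\in\mathbb{Z}_{\ge 0}^n$ be the multi-index whose $j$-th component is the number of type $j$ children of $v$. For $i\in[n]$ and $\alpha\in\mathbb{Z}_{\ge 0}^n$ let $\mathbb S_{i,\alpha}$ be the set of all $n$-type trees (with no condition on the order of siblings) whose root has type $i$ and which have exactly $\alpha_j$ leaves of type $j$ for each $j\in[n]$, and let $\vec{\mathbb S}_{i,\alpha}\subseteq\mathbb S_{i,\alpha}$ be the set of ordered ones. For a set $\mathbb S$ of such trees and complex weights $w(\mathcal T)$, the sum $\sum_{\mathcal T\in\mathbb S}w(\mathcal T)$ is understood as the series $\sum_{N\ge 1}\ \sum_{\mathcal T\in\mathbb S,\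 \mathcal T\text{ has }N\text{ vertices}}w(\mathcal T)$, whose inner sums are finite. **(1)** Let $(h_{i,\alpha}: i\in[n],\ \alpha\in\mathbb{Z}_{\ge 0}^n\setminus\{0\})$ be complex numbers such that the power series $$F_i(X)=X_i-\sum_{\alpha\neq 0}h_{i,\alpha}X^\alpha,\qquad i\in[n],$$ converge (absolutely) in an open neighbourhood $U$ of the origin in $\mathbb C^n$, and such that $\sum_{k\ge 0}A^k$ converges, where $A_{i,j}=h_{i,\mathbf e_j}$. Then for all $i$ and $\alpha$ the sum $$g_{i,\alpha}=\sum_{\mathcal T\in\vec{\mathbb S}_{i,\alpha}}\ \prod_{v\text{ internal vertex of }\mathcal T}h_{\tau(v),\mu(v)}$$ converges (absolutely, as a series over $N$), and $F=(F_1,\dots,F_n)$ has an analytic local inverse at the origin with components $F_i^{-1}(X)=\sum_{\alpha\ne 0}g_{i,\alpha}X^\alpha$. That is, $F(0)=0$, and $F$ restricts to a homeomorphism from an open neighbourhood of $0$ contained in $U$ onto an open neighbourhood $V$ of $0$, whose inverse is analytic on $V$ and has as $i$-th component the sum of the series $\sum_{\alpha\neq0}g_{i,\alpha}X^\alpha$,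 which converges absolutely on $V$. **(2)** Let $(H_{i,\alpha}: i\in[n],\ \alpha\in\mathbb{Z}_{\ge 0}^n\setminus\{0\})$ be complex numbers such that the power series $$F_i(X)=X_i-\sum_{\alpha\neq 0}\frac{H_{i,\alpha}}{\alpha!}X^\alpha,\qquad i\in[n],$$ converge (absolutely) in an open neighbourhood $U$ of the origin in $\mathbb C^n$, and such that $\sum_{k\ge 0}A^k$ converges, where $A_{i,j}=H_{i,\mathbf e_j}/\mathbf e_j!=H_{i,\mathbf e_j}$. Then the conclusion of (1) holds for this $F$ with $$g_{i,\alpha}=\sum_{\mathcal T\in\mathbb S_{i,\alpha}}\ \prod_{v\text{ internal vertex of }\mathcal T}\frac{H_{\tau(v),\mu(v)}}{|\mu(v)|!}.$$ -/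

import Mathlib

/-- Finite `n`-type trees: planar rooted trees in which every vertex carries a type in `Fin n`.
`node t m c` is the tree whose root has type `t` and `m` children, the subtrees at the children
being, from left to right, `c 0, …, c (m - 1)`.  The root is a leaf exactly when `m = 0`. -/
inductive TypedTree (n : ℕ) : Type
  | node (t : Fin n) (m : ℕ) (c : Fin m → TypedTree n) : TypedTree n

namespace TypedTree

variable {n : ℕ}

def rootType : TypedTree n → Fin n
  | node t _ _ => t

/-- The multi-index counting the children of each type, for a vertex with child subtrees `c`. -/
def childType {m : ℕ} (c : Fin m → TypedTree n) : Fin n → ℕ :=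
  fun j => (Finset.univ.filter fun k => (c k).rootType = j).card

/-- The number of vertices. -/
def size : TypedTree n → ℕ
  | node _ _ c => 1 + ∑ k, (c k).size

/-- The multi-index counting the leaves of each type. -/
def leafType : TypedTree n → Fin n → ℕ
  | node t m c => if m = 0 then Pi.single t 1 else ∑ k, (c k).leafType

/-- A tree is ordered if siblings of smaller type always lie to the left of siblings of larger
type. -/
def IsOrdered : TypedTree n → Prop
  | node _ _ c => Monotone (fun k => (c k).rootType) ∧ ∀ k, (c k).IsOrdered

/-- The product, over all internal vertices `v`, of `w (type of v) (child multi-index of v)`. -/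
def weight (w : Fin n → (Fin n → ℕ) → ℂ) : TypedTree n → ℂ
  | node t m c => if m = 0 then 1 else w t (childType c) * ∏ k, (c k).weight w

theorem one_le_size (T : TypedTree n) : 1 ≤ T.size := by
  cases T
  simp [size]

theorem finite_size_le (s : ℕ) : {T : TypedTree n | T.size ≤ s}.Finite := by
  induction s with
  | zero =>
    refine Set.finite_empty.subset fun T hT => ?_
    have := T.one_le_size
    simp only [Set.mem_ofPred_eq] at hT
    omega
  | succ s ih =>
    have hfin : ∀ m : ℕ, {c : Fin m → TypedTree n | ∀ k, (c k).size ≤ s}.Finite :=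
      fun m => Set.Finite.pi' fun _ => ih
    refine (Set.Finite.biUnion (Set.finite_Iic s) fun m _ =>
      Set.finite_iUnion fun t : Fin n => (hfin m).image (node t m)).subset ?_
    rintro ⟨t, m, c⟩ hT
    simp only [Set.mem_ofPred_eq, size] at hT
    simp only [Set.mem_iUnion, Set.mem_Iic]
    refine ⟨m, ?_, t, c, fun k => ?_, rfl⟩
    · have : ∑ _k : Fin m, 1 ≤ ∑ k, (c k).size := Finset.sum_le_sum fun k _ => (c k).one_le_size
      simp only [Finset.sum_const, Finset.card_univ, Fintype.card_fin, smul_eq_mul,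
        mul_one] at this
      omega
    · have : (c k).size ≤ ∑ k, (c k).size :=
        Finset.single_le_sum (f := fun k => (c k).size) (fun _ _ => Nat.zero_le _)
          (Finset.mem_univ k)
      omega

theorem finite_size_eq (s : ℕ) : {T : TypedTree n | T.size = s}.Finite :=
  (finite_size_le s).subset fun _ hT => le_of_eq hT

/-- The (finite) set of all `n`-type trees with exactly `N` vertices. -/
noncomputable def ofSize (n N : ℕ) : Finset (TypedTree n) :=
  (finite_size_eq (n := n) N).toFinset

/-- All `n`-type trees with root type `i` and leaf type `α`, siblings being in any order. -/
def unorderedTrees (i : Fin n) (α : Fin n → ℕ) : Set (TypedTree n) :=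
  {T | T.rootType = i ∧ T.leafType = α}

/-- The ordered `n`-type trees with root type `i` and leaf type `α`. -/
def orderedTrees (i : Fin n) (α : Fin n → ℕ) : Set (TypedTree n) :=
  {T | T.IsOrdered ∧ T.rootType = i ∧ T.leafType = α}

open Classical in
/-- The sum of the weights of the trees in `S` is `a`.  There may be infinitely many trees in `S`
(with chains of one-child vertices of any length), and under the hypotheses of interest the family
of their weights need not be absolutely summable; the sum is taken by number of vertices,
`∑_N ∑_{T ∈ S, T has N vertices} weight T`, where each inner sum is finite. -/
def HasTreeSum (S : Set (TypedTree n)) (w : Fin n → (Fin n → ℕ) → ℂ) (a : ℂ) : Prop :=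
  HasSum (fun N : ℕ => ∑ T ∈ (ofSize n N).filter (fun T => T ∈ S), T.weight w) a

end TypedTree

namespace SeriesInversion

/-- The monomial `x ^ α`. -/
def monom {n : ℕ} (x : Fin n → ℂ) (α : Fin n → ℕ) : ℂ := ∏ j, x j ^ α j

/-- Convergence on `U` of all the power series `∑_{α ≠ 0} h i α x ^ α`. -/
def ConvergesOn {n : ℕ} (h : Fin n → (Fin n → ℕ) → ℂ) (U : Set (Fin n → ℂ)) : Prop :=
  ∀ x ∈ U, ∀ i, Summable fun α : {α : Fin n → ℕ // α ≠ 0} => h i α * monom x α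

/-- The map with components `x i - ∑_{α ≠ 0} h i α x ^ α`. -/
noncomputable def seriesMap {n : ℕ} (h : Fin n → (Fin n → ℕ) → ℂ) (x : Fin n → ℂ) : Fin n → ℂ :=
  fun i => x i - ∑' α : {α : Fin n → ℕ // α ≠ 0}, h i α * monom x α

/-- The matrix of linear coefficients, `A i j = h i e_j`. -/
def linearPart {n : ℕ} (h : Fin n → (Fin n → ℕ) → ℂ) : Matrix (Fin n) (Fin n) ℂ :=
  Matrix.of fun i j => h i (Pi.single j 1)

/-- The series `∑_k A ^ k` converges. -/
def NeumannConverges {n : ℕ} (A : Matrix (Fin n) (Fin n) ℂ) : Prop :=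
  ∃ S : Matrix (Fin n) (Fin n) ℂ,
    Filter.Tendsto (fun K => ∑ k ∈ Finset.range K, A ^ k) Filter.atTop (nhds S)

/-- `F`, considered on `U`, restricts to a homeomorphism `e` fixing the origin from an open
neighbourhood of the origin in `U` onto an open neighbourhood of the origin; the inverse of `e` is
analytic, and its components are the sums of the power series `∑_{α ≠ 0} g i α y ^ α`. -/
def HasAnalyticInverse {n : ℕ} (F : (Fin n → ℂ) → Fin n → ℂ) (U : Set (Fin n → ℂ))
    (g : Fin n → (Fin n → ℕ) → ℂ) : Prop :=
  ∃ e : OpenPartialHomeomorph (Fin n → ℂ) (Fin n → ℂ),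
    (0 : Fin n → ℂ) ∈ e.source ∧ e.source ⊆ U ∧ Set.EqOn e F e.source ∧ e 0 = 0 ∧
    AnalyticOnNhd ℂ e.symm e.target ∧
    ∀ y ∈ e.target, ∀ i,
      HasSum (fun α : {α : Fin n → ℕ // α ≠ 0} => g i α * monom y α) (e.symm y i)

/-- `α! = ∏ j, (α j)!`. -/
def multiFactorial {n : ℕ} (α : Fin n → ℕ) : ℕ := ∏ j, (α j).factorial

end SeriesInversion

/-!
Give a vertex an extra variable `t`, an internal vertex its weight and a leaf of type `i` the
variable `X i`.  The generating series `G i` of the trees with root type `i` then solve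
`G = t * (X + ∑ β ≠ 0, h β * G ^ β)`, so at `t = 1` they form, formally, a right inverse of `F`.

Since there may be cancellation in the powers of `A`, convergence at `t = 1` cannot be obtained from
absolute summability over trees.  Instead, convergence of `∑ A ^ k` forces `A ^ k → 0` and hence
`∑ ‖A ^ k‖ < ∞`.  Solving the linear part of the recurrence for the coefficients of `t ^ N` through
the powers of `A` leaves only terms of degree at least two in `G` on the right, and for small `X`
this bounds the partial sums of the norms of the coefficients, uniformly in `N`.  The sum at `t = 1`
is therefore an analytic right inverse of `F`, and it is the local inverse because `dF(0) = 1 - A`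
is invertible.
-/

namespace SeriesInversion

open Finset

section Tuples

variable {ι κ : Type*} [DecidableEq ι] [Fintype κ]

/-- The multi-index counting how often each value is taken by the tuple `j`.  In a typed tree it
is the child multi-index of a vertex whose children have the types `j`. -/
def fiberCard (j : κ → ι) : ι → ℕ := fun l => #{k | j k = l}

theorem fiberCard_comp_equiv (j : κ → ι) (e : κ ≃ κ) : fiberCard (j ∘ e) = fiberCard j :=
  funext fun _ => card_equiv e (by simp)

theorem count_ofFn {m : ℕ} (j : Fin m → ι) (l : ι) : (List.ofFn j).count l = fiberCard j l := by
  rw [List.ofFn_eq_map, ← Multiset.coe_count, ← Multiset.map_coe, Multiset.count_map]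
  simp only [eq_comm (a := l)]
  rfl

variable [Fintype ι]

theorem sum_fiberCard (j : κ → ι) : ∑ l, fiberCard j l = Fintype.card κ :=
  (card_eq_sum_card_fiberwise (f := j) (by simp)).symm

theorem prod_comp_eq_prod_pow_fiberCard {M : Type*} [CommMonoid M] (f : ι → M) (j : κ → ι) :
    ∏ k, f (j k) = ∏ l, f l ^ fiberCard j l := by
  simp only [← prod_fiberwise' univ j, prod_const, fiberCard]

theorem fiberCard_mem_piAntidiag {m : ℕ} (j : Fin m → ι) : fiberCard j ∈ piAntidiag univ m := by
  simp [sum_fiberCard]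

theorem sum_tuples_eq_sum_piAntidiag {m : ℕ} {M : Type*} [AddCommMonoid M]
    (f : (Fin m → ι) → M) :
    ∑ j, f j = ∑ β ∈ piAntidiag univ m, ∑ j with fiberCard j = β, f j :=
  (sum_fiberwise_of_maps_to (fun j _ => fiberCard_mem_piAntidiag j) f).symm

/-- Compare the coefficients of a monomial in the two expansions of `(∑ l, X l) ^ m`. -/
theorem card_filter_fiberCard_eq {m : ℕ} {β : ι → ℕ} (hβ : β ∈ piAntidiag univ m) :
    #{j : Fin m → ι | fiberCard j = β} = Nat.multinomial univ β := by
  have prod_X_pow (γ : ι → ℕ) : ∏ l, (MvPolynomial.X l : MvPolynomial ι ℕ) ^ γ l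
      = MvPolynomial.monomial (Finsupp.equivFunOnFinite.symm γ) 1 := by
    simp [MvPolynomial.monomial_eq, Finsupp.prod_fintype]
  have tuples : (∑ l, (MvPolynomial.X l : MvPolynomial ι ℕ)) ^ m
      = ∑ j : Fin m → ι, MvPolynomial.monomial (Finsupp.equivFunOnFinite.symm (fiberCard j)) 1 := by
    simp_rw [← prod_X_pow, ← prod_comp_eq_prod_pow_fiberCard, Fintype.sum_pow]
  have multinomial := sum_pow_eq_sum_piAntidiag univ
    (fun l : ι => (MvPolynomial.X l : MvPolynomial ι ℕ)) m
  rw [tuples] at multinomial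
  replace multinomial := congrArg (MvPolynomial.coeff (Finsupp.equivFunOnFinite.symm β)) multinomial
  simpa [prod_X_pow, MvPolynomial.coeff_sum, MvPolynomial.coeff_monomial, ← nsmul_eq_mul,
    MvPolynomial.coeff_smul, hβ, -mem_piAntidiag] using multinomial

theorem exists_fiberCard_eq {m : ℕ} {β : ι → ℕ} (hβ : β ∈ piAntidiag univ m) :
    ∃ j : Fin m → ι, fiberCard j = β := by
  obtain ⟨j, hj⟩ := card_pos.1 <|
    (card_filter_fiberCard_eq hβ).symm ▸ Nat.multinomial_pos univ β
  exact ⟨j, (mem_filter.1 hj).2⟩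

end Tuples

section MonotoneTuples

variable {ι : Type*} [LinearOrder ι] {m : ℕ}

theorem eq_of_monotone_of_fiberCard_eq {j j' : Fin m → ι} (hj : Monotone j) (hj' : Monotone j')
    (h : fiberCard j = fiberCard j') : j = j' := by
  have perm : (List.ofFn j).Perm (List.ofFn j') :=
    List.perm_iff_count.2 fun l => by rw [count_ofFn, count_ofFn, h]
  exact List.ofFn_injective <|
    perm.eq_of_sortedLE (List.sortedLE_ofFn_iff.2 hj) (List.sortedLE_ofFn_iff.2 hj')

theorem existsUnique_monotone_fiberCard_eq [Fintype ι] {β : ι → ℕ} (hβ : β ∈ piAntidiag univ m) :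
    ∃! j : Fin m → ι, fiberCard j = β ∧ Monotone j := by
  obtain ⟨j, rfl⟩ := exists_fiberCard_eq hβ
  have sorted : fiberCard (j ∘ Tuple.sort j) = fiberCard j := fiberCard_comp_equiv j _
  exact ⟨j ∘ Tuple.sort j, ⟨sorted, Tuple.monotone_sort j⟩, fun j' hj' =>
    eq_of_monotone_of_fiberCard_eq hj'.2 (Tuple.monotone_sort j) (hj'.1.trans sorted.symm)⟩

theorem card_filter_fiberCard_eq_and_monotone [Fintype ι]
    [DecidablePred (Monotone : (Fin m → ι) → Prop)] {β : ι → ℕ} (hβ : β ∈ piAntidiag univ m) :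
    #{j : Fin m → ι | fiberCard j = β ∧ Monotone j} = 1 := by
  obtain ⟨j, hj, unique⟩ := existsUnique_monotone_fiberCard_eq hβ
  exact card_eq_one.2 ⟨j, ext fun j' => by simpa using ⟨unique j', fun h => h ▸ hj⟩⟩

open Classical in
theorem sum_monotone_tuples [Fintype ι] {M : Type*} [AddCommMonoid M] (f : (ι → ℕ) → M) :
    ∑ j : Fin m → ι with Monotone j, f (fiberCard j) = ∑ β ∈ piAntidiag univ m, f β := by
  refine sum_bij (fun j _ => fiberCard j) (fun j _ => fiberCard_mem_piAntidiag j) ?_ ?_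
    (fun _ _ => rfl)
  · exact fun j hj j' hj' =>
      eq_of_monotone_of_fiberCard_eq (mem_filter.1 hj).2 (mem_filter.1 hj').2
  · intro β hβ
    obtain ⟨j, ⟨hj, mono⟩, -⟩ := existsUnique_monotone_fiberCard_eq hβ
    exact ⟨j, by simpa using mono, hj⟩

end MonotoneTuples

theorem ne_zero_of_mem_piAntidiag {ι : Type*} [DecidableEq ι] [Fintype ι] {m : ℕ} (hm : m ≠ 0)
    {β : ι → ℕ} (hβ : β ∈ piAntidiag univ m) : β ≠ 0 := by
  rintro rfl
  exact hm ((mem_piAntidiag.1 hβ).1.symm.trans sum_const_zero)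

theorem sum_piAntidiag_one {ι : Type*} [DecidableEq ι] [Fintype ι] {M : Type*} [AddCommMonoid M]
    (f : (ι → ℕ) → M) : ∑ β ∈ piAntidiag univ 1, f β = ∑ j, f (Pi.single j 1) := by
  have fiberCard_fin_one (j : Fin 1 → ι) : fiberCard j = Pi.single (j 0) 1 := by
    funext l
    simp [fiberCard, Pi.single_apply, eq_comm (a := l), filter_singleton, apply_ite]
  refine (sum_bij (fun j _ => Pi.single j 1) (by simp) ?_ ?_ fun _ _ => rfl).symm
  · intro j _ j' _ h
    simpa [Pi.single_apply] using congrFun h j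
  · intro β hβ
    obtain ⟨j, rfl⟩ := exists_fiberCard_eq hβ
    exact ⟨j 0, mem_univ _, (fiberCard_fin_one j).symm⟩

end SeriesInversion

namespace TypedTree

open Finset PowerSeries SeriesInversion

variable {n : ℕ} {R : Type*} [CommSemiring R]

theorem mem_ofSize {N : ℕ} {T : TypedTree n} : T ∈ ofSize n N ↔ T.size = N := by
  simp [ofSize]

/-- The product over all vertices, leaves included, of weights which depend on the type of the
vertex and the tuple of the types of its children. -/
def vertexProd (W : Fin n → ∀ m, (Fin m → Fin n) → R) : TypedTree n → R
  | node t m c => W t m (fun k => (c k).rootType) * ∏ k, (c k).vertexProd W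

/-- The generating series, by number of vertices, of the trees with root type `i`. -/
noncomputable def treeSeries (W : Fin n → ∀ m, (Fin m → Fin n) → R) (i : Fin n) : R⟦X⟧ :=
  PowerSeries.mk fun N => ∑ T ∈ ofSize n N with T.rootType = i, T.vertexProd W

theorem coeff_treeSeries (W : Fin n → ∀ m, (Fin m → Fin n) → R) (i : Fin n) (N : ℕ) :
    coeff N (treeSeries W i) = ∑ T ∈ ofSize n N with T.rootType = i, T.vertexProd W :=
  coeff_mk _ _

theorem coeff_zero_treeSeries (W : Fin n → ∀ m, (Fin m → Fin n) → R) (i : Fin n) :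
    coeff 0 (treeSeries W i) = 0 := by
  rw [coeff_treeSeries]
  refine sum_eq_zero fun T hT => absurd T.one_le_size ?_
  rw [mem_ofSize.1 (mem_filter.1 hT).1]
  exact Nat.not_succ_le_zero 0

theorem card_le_sum_size {m : ℕ} (c : Fin m → TypedTree n) : m ≤ ∑ k, (c k).size := by
  simpa using sum_le_sum fun k (_ : k ∈ univ) => (c k).one_le_size

theorem sum_ofSize_succ {M : Type*} [AddCommMonoid M] (i : Fin n) (N : ℕ) (f : TypedTree n → M) :
    ∑ T ∈ ofSize n (N + 1) with T.rootType = i, f T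
      = ∑ m ∈ range (N + 1), ∑ l ∈ finsuppAntidiag (univ : Finset (Fin m)) N,
          ∑ c ∈ Fintype.piFinset fun k => ofSize n (l k), f (node i m c) := by
  classical
  simp_rw [sum_sigma']
  symm
  refine sum_bij (fun p _ => node i p.1 p.2.2) ?_ ?_ ?_ (fun _ _ => rfl)
  · rintro ⟨m, l, c⟩ hp
    simp only [mem_sigma, mem_range, mem_finsuppAntidiag, Fintype.mem_piFinset, mem_ofSize] at hp
    refine mem_filter.2 ⟨mem_ofSize.2 ?_, rfl⟩
    rw [size, sum_congr rfl fun k _ => hp.2.2 k, hp.2.1.1, add_comm]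
  · rintro ⟨m, l, c⟩ hp ⟨m', l', c'⟩ hp' h
    simp only [mem_sigma, mem_range, mem_finsuppAntidiag, Fintype.mem_piFinset, mem_ofSize]
      at hp hp'
    simp only [node.injEq, true_and] at h
    obtain ⟨rfl, h⟩ := h
    obtain rfl := eq_of_heq h
    have : l = l' := by
      ext k
      rw [← hp.2.2 k, hp'.2.2 k]
    rw [this]
  · rintro ⟨t, m, c⟩ hT
    obtain ⟨hs, rfl⟩ := mem_filter.1 hT
    rw [mem_ofSize, size] at hs
    have hm := card_le_sum_size c
    refine ⟨⟨m, Finsupp.equivFunOnFinite.symm fun k => (c k).size, c⟩, ?_, rfl⟩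
    simp only [mem_sigma, mem_range, mem_finsuppAntidiag, Fintype.mem_piFinset, mem_ofSize]
    refine ⟨by omega, ⟨?_, subset_univ _⟩, fun k => by simp⟩
    simp only [Finsupp.equivFunOnFinite_symm_apply_apply]
    omega

theorem coeff_succ_treeSeries (W : Fin n → ∀ m, (Fin m → Fin n) → R) (i : Fin n) (N : ℕ) :
    coeff (N + 1) (treeSeries W i) = ∑ m ∈ range (N + 1), ∑ j : Fin m → Fin n,
      W i m j * coeff N (∏ k, treeSeries W (j k)) := by
  rw [coeff_treeSeries, sum_ofSize_succ]
  refine sum_congr rfl fun m _ => ?_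
  simp_rw [PowerSeries.coeff_prod, mul_sum]
  rw [sum_comm]
  refine sum_congr rfl fun l _ => ?_
  simp_rw [coeff_treeSeries, prod_univ_sum, mul_sum]
  rw [← sum_fiberwise (s := Fintype.piFinset _) (g := fun c k => (c k).rootType)]
  refine sum_congr rfl fun j _ => sum_congr ?_ fun c hc => ?_
  · ext c
    simp [Fintype.mem_piFinset, funext_iff, forall_and]
  · have rootType_c : (fun k => (c k).rootType) = j :=
      funext fun k => (mem_filter.1 (Fintype.mem_piFinset.1 hc k)).2
    rw [vertexProd, rootType_c]

end TypedTree

namespace SeriesInversion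

open Finset PowerSeries

section FormalSolution

variable {ι : Type*} [DecidableEq ι] [Fintype ι]

/-- The series `G i`, in a variable `t`, have no constant term and solve
`G i = t * ∑ β, w i β * G ^ β`.  The sum over `β` is cut off where the power `G ^ β` no longer
contributes to a given coefficient, so that no topology on the power series is needed. -/
structure IsSolution {R : Type*} [CommSemiring R] (w : ι → (ι → ℕ) → R) (G : ι → R⟦X⟧) :
    Prop where
  coeff_zero : ∀ i, coeff 0 (G i) = 0
  coeff_succ : ∀ i N, coeff (N + 1) (G i)
    = ∑ m ∈ range (N + 1), ∑ β ∈ piAntidiag univ m, w i β * coeff N (∏ l, G l ^ β l)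

theorem isSolution_treeSeries {n : ℕ} {R : Type*} [CommSemiring R]
    {W : Fin n → ∀ m, (Fin m → Fin n) → R} {w : Fin n → (Fin n → ℕ) → R}
    (h : ∀ i m, ∀ β ∈ piAntidiag univ m, ∑ j with fiberCard j = β, W i m j = w i β) :
    IsSolution w (TypedTree.treeSeries W) where
  coeff_zero := TypedTree.coeff_zero_treeSeries W
  coeff_succ i N := by
    rw [TypedTree.coeff_succ_treeSeries]
    refine sum_congr rfl fun m _ => ?_
    rw [sum_tuples_eq_sum_piAntidiag]
    refine sum_congr rfl fun β hβ => ?_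
    rw [← h i m β hβ, sum_mul]
    refine sum_congr rfl fun j hj => ?_
    rw [prod_comp_eq_prod_pow_fiberCard, (mem_filter.1 hj).2]

variable {R S : Type*} [CommSemiring R] [CommSemiring S] {w : ι → (ι → ℕ) → R} {G : ι → R⟦X⟧}

theorem IsSolution.map (φ : R →+* S) (hG : IsSolution w G) :
    IsSolution (fun i β => φ (w i β)) (fun i => PowerSeries.map φ (G i)) where
  coeff_zero i := by rw [coeff_map, hG.coeff_zero, map_zero]
  coeff_succ i N := by
    simp_rw [coeff_map, hG.coeff_succ, map_sum, map_mul, ← map_pow, ← map_prod, coeff_map]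

theorem IsSolution.X_pow_dvd (hG : IsSolution w G) (hw : ∀ i, w i 0 = 0) (N : ℕ) (i : ι) :
    X ^ N ∣ G i := by
  induction N generalizing i with
  | zero => exact one_dvd _
  | succ N ih =>
    refine X_pow_dvd_iff.2 fun k hk => ?_
    obtain _ | k := k
    · exact hG.coeff_zero i
    rw [hG.coeff_succ]
    refine sum_eq_zero fun m _ => sum_eq_zero fun β _ => ?_
    obtain rfl | hβ := eq_or_ne β 0
    · rw [hw, zero_mul]
    obtain ⟨l, hl⟩ := Function.ne_iff.1 hβ
    have dvd : X ^ N ∣ ∏ l, G l ^ β l :=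
      ((ih l).trans (dvd_pow_self _ hl)).trans (dvd_prod_of_mem _ (mem_univ l))
    rw [X_pow_dvd_iff.1 dvd k (Nat.lt_of_succ_lt_succ hk), mul_zero]

theorem IsSolution.eq_zero (hG : IsSolution w G) (hw : ∀ i, w i 0 = 0) (i : ι) : G i = 0 :=
  PowerSeries.ext fun N =>
    X_pow_dvd_iff.1 (hG.X_pow_dvd hw (N + 1) i) N N.lt_succ_self

end FormalSolution

theorem sum_antidiagonal_mul_le {a b : ℕ → ℝ} (ha : ∀ k, 0 ≤ a k) (hb : ∀ k, 0 ≤ b k) (M : ℕ) :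
    ∑ N ∈ range M, ∑ p ∈ antidiagonal N, a p.1 * b p.2
      ≤ (∑ k ∈ range M, a k) * ∑ k ∈ range M, b k := by
  have antidiagonal_eq (N : ℕ) (hN : N ∈ range M) : antidiagonal N
      = {p ∈ {p ∈ range M ×ˢ range M | p.1 + p.2 < M} | p.1 + p.2 = N} := by
    ext p
    simp only [HasAntidiagonal.mem_antidiagonal, mem_filter, mem_product, mem_range] at hN ⊢
    omega
  rw [sum_congr rfl fun N hN => sum_congr (antidiagonal_eq N hN) fun _ _ => rfl,
    sum_fiberwise_of_maps_to (g := fun p : ℕ × ℕ => p.1 + p.2) (by simp), sum_mul_sum,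
    ← sum_product']
  exact sum_le_sum_of_subset_of_nonneg (filter_subset _ _)
    fun p _ _ => mul_nonneg (ha p.1) (hb p.2)

section Recurrence

open scoped Matrix.Norms.Operator

variable {ι : Type*} [Fintype ι] [DecidableEq ι]

theorem eq_sum_antidiagonal_of_recurrence {R : Type*} [Semiring R] {A : Matrix ι ι R}
    {g u : ℕ → ι → R} (h0 : g 0 = 0) (hg : ∀ N, g (N + 1) = A.mulVec (g N) + u N) (N : ℕ) :
    g (N + 1) = ∑ p ∈ antidiagonal N, (A ^ p.1).mulVec (u p.2) := by
  induction N with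
  | zero => simp [hg, h0]
  | succ N ih =>
    rw [hg, Nat.sum_antidiagonal_succ, add_comm, ih]
    simp [Matrix.mulVec_sum, Matrix.mulVec_mulVec, pow_succ']

variable {R : Type*} [SeminormedRing R]

theorem sum_norm_le_of_recurrence {A : Matrix ι ι R} {g u : ℕ → ι → R} (h0 : g 0 = 0)
    (hg : ∀ N, g (N + 1) = A.mulVec (g N) + u N) (M : ℕ) :
    ∑ N ∈ range (M + 1), ‖g N‖ ≤ (∑ k ∈ range M, ‖A ^ k‖) * ∑ k ∈ range M, ‖u k‖ := by
  rw [sum_range_succ', h0, norm_zero, add_zero]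
  refine le_trans (sum_le_sum fun N _ => ?_)
    (sum_antidiagonal_mul_le (fun k => norm_nonneg (A ^ k)) (fun k => norm_nonneg (u k)) M)
  rw [eq_sum_antidiagonal_of_recurrence h0 hg]
  exact norm_sum_le_of_le _ fun p _ => Matrix.linfty_opNorm_mulVec _ _

end Recurrence

section PartialNorm

variable {R : Type*} [SeminormedCommRing R]

/-- The sum of the norms of the coefficients of degree less than `M`.  Unlike the full `ℓ¹` norm it
is always finite, and it is submultiplicative all the same. -/
noncomputable def partialNorm (M : ℕ) (f : R⟦X⟧) : ℝ := ∑ N ∈ range M, ‖coeff N f‖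

theorem partialNorm_nonneg (M : ℕ) (f : R⟦X⟧) : 0 ≤ partialNorm M f :=
  sum_nonneg fun _ _ => norm_nonneg _

theorem partialNorm_mul_le (M : ℕ) (f g : R⟦X⟧) :
    partialNorm M (f * g) ≤ partialNorm M f * partialNorm M g := by
  refine le_trans (sum_le_sum fun N _ => ?_)
    (sum_antidiagonal_mul_le (fun k => norm_nonneg (coeff k f))
      (fun k => norm_nonneg (coeff k g)) M)
  rw [coeff_mul]
  exact norm_sum_le_of_le _ fun p _ => norm_mul_le _ _

variable [NormOneClass R]

theorem partialNorm_one_le (M : ℕ) : partialNorm M (1 : R⟦X⟧) ≤ 1 := by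
  simp_rw [partialNorm, coeff_one, apply_ite norm, norm_one, norm_zero, sum_ite_eq']
  split_ifs <;> simp

theorem partialNorm_prod_le {κ : Type*} (M : ℕ) (t : Finset κ) (f : κ → R⟦X⟧) :
    partialNorm M (∏ k ∈ t, f k) ≤ ∏ k ∈ t, partialNorm M (f k) := by
  classical
  induction t using Finset.induction_on with
  | empty => exact partialNorm_one_le M
  | insert a t ha ih =>
    rw [prod_insert ha, prod_insert ha]
    exact (partialNorm_mul_le M _ _).trans
      (mul_le_mul_of_nonneg_left ih (partialNorm_nonneg M _))

theorem partialNorm_prod_pow_le {ι : Type*} [Fintype ι] {M : ℕ} {G : ι → R⟦X⟧} {s : ℝ}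
    (hG : ∀ i, partialNorm M (G i) ≤ s) (β : ι → ℕ) :
    partialNorm M (∏ l, G l ^ β l) ≤ s ^ ∑ l, β l := by
  have pow_le (l : ι) : partialNorm M (G l ^ β l) ≤ s ^ β l := by
    calc partialNorm M (G l ^ β l) ≤ partialNorm M (G l) ^ β l := by
          simpa using partialNorm_prod_le M (range (β l)) fun _ => G l
      _ ≤ s ^ β l := pow_le_pow_left₀ (partialNorm_nonneg M _) (hG l) _
  rw [← prod_pow_eq_pow_sum]
  exact (partialNorm_prod_le M univ _).trans
    (prod_le_prod (fun l _ => partialNorm_nonneg M _) fun l _ => pow_le l)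

end PartialNorm

section APriori

open scoped Matrix.Norms.Operator

variable {ι R : Type*} [Fintype ι] [DecidableEq ι]

/-- The contribution of the terms of degree at least two in `G` to the right-hand sides of the
equations `G i = t * ∑ β, w i β * G ^ β`, in degree `N + 1`. -/
noncomputable def higherTerm [CommSemiring R] (w : ι → (ι → ℕ) → R) (G : ι → R⟦X⟧) (N : ℕ) :
    ι → R :=
  ∑ m ∈ Ico 2 (N + 1), ∑ β ∈ piAntidiag univ m, coeff N (∏ l, G l ^ β l) • fun i => w i β

theorem IsSolution.coeff_succ_eq_mulVec_add [CommSemiring R] {w : ι → (ι → ℕ) → R}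
    {G : ι → R⟦X⟧} (hG : IsSolution w G) (N : ℕ) :
    (fun i => coeff (N + 1) (G i))
      = (Matrix.of fun i j => w i (Pi.single j 1)).mulVec (fun j => coeff N (G j))
        + ((if N = 0 then fun i => w i 0 else 0) + higherTerm w G N) := by
  funext i
  have linear : ∑ β ∈ piAntidiag univ 1, w i β * coeff N (∏ l, G l ^ β l)
      = ∑ j, w i (Pi.single j 1) * coeff N (G j) := by
    simp_rw [sum_piAntidiag_one, Pi.single_apply, pow_ite, pow_one, pow_zero, prod_ite_eq' univ,
      mem_univ, if_true]
  rw [hG.coeff_succ]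
  obtain _ | N := N
  · simp [hG.coeff_zero, higherTerm, Matrix.mulVec, dotProduct]
  · rw [range_eq_Ico, sum_eq_sum_Ico_succ_bot (by omega), sum_eq_sum_Ico_succ_bot (by omega),
      linear]
    simp [higherTerm, Matrix.mulVec, dotProduct, coeff_one, mul_comm]

variable [SeminormedCommRing R] [NormOneClass R] {w : ι → (ι → ℕ) → R} {G : ι → R⟦X⟧}

theorem sum_norm_higherTerm_le {K s ρ : ℝ} {M : ℕ}
    (hK : ∑ m ∈ Ico 2 M, ∑ β ∈ piAntidiag univ m, ‖fun i => w i β‖ * ρ ^ m ≤ K)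
    (hs : 0 ≤ s) (hρ : 0 < ρ) (hsρ : s ≤ ρ) (hG : ∀ i, partialNorm M (G i) ≤ s) :
    ∑ N ∈ range M, ‖higherTerm w G N‖ ≤ K * (s / ρ) ^ 2 := by
  have norm_higherTerm_le (N : ℕ) (hN : N ∈ range M) : ‖higherTerm w G N‖
      ≤ ∑ m ∈ Ico 2 M, ∑ β ∈ piAntidiag univ m, ‖fun i => w i β‖ * ‖coeff N (∏ l, G l ^ β l)‖ := by
    refine (norm_sum_le_of_le _ fun m _ => norm_sum_le_of_le _ fun β _ =>
      (norm_smul_le _ _).trans_eq (mul_comm _ _)).trans ?_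
    exact sum_le_sum_of_subset_of_nonneg (Ico_subset_Ico le_rfl (mem_range.1 hN))
      fun m _ _ => by positivity
  have pow_le {m : ℕ} (hm : m ∈ Ico 2 M) : s ^ m ≤ ρ ^ m * (s / ρ) ^ 2 := by
    calc s ^ m = ρ ^ m * (s / ρ) ^ m := by rw [← mul_pow, mul_div_cancel₀ _ hρ.ne']
      _ ≤ ρ ^ m * (s / ρ) ^ 2 := by
          gcongr ρ ^ m * ?_
          exact pow_le_pow_of_le_one (by positivity) ((div_le_one hρ).2 hsρ) (mem_Ico.1 hm).1
  calc ∑ N ∈ range M, ‖higherTerm w G N‖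
      ≤ ∑ N ∈ range M, ∑ m ∈ Ico 2 M, ∑ β ∈ piAntidiag univ m,
          ‖fun i => w i β‖ * ‖coeff N (∏ l, G l ^ β l)‖ := sum_le_sum norm_higherTerm_le
    _ = ∑ m ∈ Ico 2 M, ∑ β ∈ piAntidiag univ m,
          ‖fun i => w i β‖ * partialNorm M (∏ l, G l ^ β l) := by
        simp_rw [partialNorm, mul_sum]
        rw [sum_comm]
        exact sum_congr rfl fun m _ => sum_comm
    _ ≤ ∑ m ∈ Ico 2 M, ∑ β ∈ piAntidiag univ m, ‖fun i => w i β‖ * (ρ ^ m * (s / ρ) ^ 2) := by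
        refine sum_le_sum fun m hm => sum_le_sum fun β hβ => ?_
        gcongr
        refine (partialNorm_prod_pow_le hG β).trans ?_
        rw [(mem_piAntidiag.1 hβ).1]
        exact pow_le hm
    _ = (∑ m ∈ Ico 2 M, ∑ β ∈ piAntidiag univ m, ‖fun i => w i β‖ * ρ ^ m) * (s / ρ) ^ 2 := by
        simp_rw [sum_mul, mul_assoc]
    _ ≤ K * (s / ρ) ^ 2 := by gcongr

theorem IsSolution.sum_norm_coeff_le (hG : IsSolution w G) {C K r s ρ : ℝ}
    (hC : ∀ M, ∑ k ∈ range M, ‖(Matrix.of fun i j => w i (Pi.single j 1)) ^ k‖ ≤ C)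
    (hr : ‖fun i => w i 0‖ ≤ r)
    (hK : ∀ M, ∑ m ∈ Ico 2 M, ∑ β ∈ piAntidiag univ m, ‖fun i => w i β‖ * ρ ^ m ≤ K)
    (hs : 0 ≤ s) (hρ : 0 < ρ) (hsρ : s ≤ ρ) (hle : C * (r + K * (s / ρ) ^ 2) ≤ s) (M : ℕ) :
    ∑ N ∈ range M, ‖fun i => coeff N (G i)‖ ≤ s := by
  have coeff_zero : (fun i => coeff 0 (G i)) = 0 := funext hG.coeff_zero
  induction M with
  | zero => simpa using hs
  | succ M ih =>
    have partialNorm_le (i : ι) : partialNorm M (G i) ≤ s :=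
      (sum_le_sum fun N _ => norm_le_pi_norm (fun i => coeff N (G i)) i).trans ih
    have inhomogeneity_le : ∑ N ∈ range M,
        ‖(if N = 0 then fun i => w i 0 else 0) + higherTerm w G N‖ ≤ r + K * (s / ρ) ^ 2 := by
      refine (sum_le_sum fun N _ => norm_add_le _ _).trans ?_
      rw [sum_add_distrib]
      refine add_le_add ?_ (sum_norm_higherTerm_le (hK M) hs hρ hsρ partialNorm_le)
      simp_rw [apply_ite norm, norm_zero, sum_ite_eq']
      split_ifs
      exacts [hr, (norm_nonneg _).trans hr]
    refine (sum_norm_le_of_recurrence coeff_zero hG.coeff_succ_eq_mulVec_add M).trans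
      (le_trans ?_ hle)
    exact mul_le_mul (hC M) inhomogeneity_le (by positivity) (by simpa using hC 0)

end APriori

theorem exists_radii {C K ρ : ℝ} (hC : 0 ≤ C) (hK : 0 ≤ K) (hρ : 0 < ρ) :
    ∃ r s : ℝ, 0 < r ∧ 0 < s ∧ s ≤ ρ ∧ C * (r + K * (s / ρ) ^ 2) ≤ s := by
  set s : ℝ := min ρ (ρ ^ 2 / (2 * C * K + 1))
  have hs : 0 < s := lt_min hρ (by positivity)
  refine ⟨s / (2 * C + 1), s, by positivity, hs, min_le_left _ _, ?_⟩
  have linear_le : C * (s / (2 * C + 1)) ≤ s / 2 := by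
    rw [mul_div_assoc', div_le_div_iff₀ (by positivity) (by positivity)]
    linarith
  have quadratic_le : C * (K * (s / ρ) ^ 2) ≤ s / 2 := by
    have s_mul_le : s * (2 * C * K + 1) ≤ ρ ^ 2 :=
      (le_div_iff₀ (by positivity)).1 (min_le_right _ _)
    rw [div_pow, mul_div_assoc', mul_div_assoc', div_le_div_iff₀ (by positivity) (by positivity)]
    nlinarith [mul_le_mul_of_nonneg_left s_mul_le hs.le]
  linarith

section AbsoluteSum

variable {R : Type*} [NormedCommRing R]

/-- The series `f`, evaluated at `t = 1`, converges absolutely with sum `a`. -/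
structure HasAbsSum (f : R⟦X⟧) (a : R) : Prop where
  summable : Summable fun N => ‖coeff N f‖
  hasSum : HasSum (fun N => coeff N f) a

theorem hasAbsSum_tsum [CompleteSpace R] {f : R⟦X⟧} {s : ℝ} (h : ∀ M, partialNorm M f ≤ s) :
    HasAbsSum f (∑' N, coeff N f) :=
  have summable := summable_of_sum_range_le (fun _ => norm_nonneg _) h
  ⟨summable, summable.of_norm.hasSum⟩

theorem HasAbsSum.one : HasAbsSum (1 : R⟦X⟧) 1 where
  summable := summable_of_ne_finset_zero (s := {0}) fun N hN => by
    rw [coeff_one, if_neg (by simpa using hN), norm_zero]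
  hasSum := by simpa only [coeff_one] using hasSum_ite_eq 0 (1 : R)

variable [CompleteSpace R]

theorem HasAbsSum.mul {f g : R⟦X⟧} {a b : R} (hf : HasAbsSum f a) (hg : HasAbsSum g b) :
    HasAbsSum (f * g) (a * b) := by
  have summable : Summable fun N => ‖coeff N (f * g)‖ := by
    simpa only [coeff_mul] using
      summable_norm_sum_mul_antidiagonal_of_summable_norm hf.summable hg.summable
  refine ⟨summable, ?_⟩
  rw [← hf.hasSum.tsum_eq, ← hg.hasSum.tsum_eq,
    tsum_mul_tsum_eq_tsum_sum_antidiagonal_of_summable_norm hf.summable hg.summable]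
  simpa only [coeff_mul] using summable.of_norm.hasSum

theorem HasAbsSum.prod {κ : Type*} {f : κ → R⟦X⟧} {a : κ → R} {t : Finset κ}
    (hf : ∀ k ∈ t, HasAbsSum (f k) (a k)) : HasAbsSum (∏ k ∈ t, f k) (∏ k ∈ t, a k) := by
  classical
  induction t using Finset.induction_on with
  | empty => exact HasAbsSum.one
  | insert k t hk ih =>
    rw [prod_insert hk, prod_insert hk]
    exact (hf k (mem_insert_self k t)).mul (ih fun l hl => hf l (mem_insert_of_mem hl))

theorem HasAbsSum.pow {f : R⟦X⟧} {a : R} (hf : HasAbsSum f a) (k : ℕ) :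
    HasAbsSum (f ^ k) (a ^ k) := by
  simpa using HasAbsSum.prod (t := range k) fun _ _ => hf

end AbsoluteSum

section Evaluation

variable {ι R : Type*} [Fintype ι]

theorem IsSolution.coeff_prod_pow_eq_zero [DecidableEq ι] [CommSemiring R]
    {w : ι → (ι → ℕ) → R} {G : ι → R⟦X⟧} (hG : IsSolution w G) {N : ℕ} {β : ι → ℕ}
    (h : N < ∑ l, β l) : coeff N (∏ l, G l ^ β l) = 0 := by
  have dvd : (X : R⟦X⟧) ^ (∑ l, β l) ∣ ∏ l, G l ^ β l := by
    rw [← prod_pow_eq_pow_sum]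
    refine prod_dvd_prod_of_dvd _ _ fun l _ => pow_dvd_pow_of_dvd ?_ _
    rw [X_dvd_iff, ← coeff_zero_eq_constantCoeff_apply]
    exact hG.coeff_zero l
  exact X_pow_dvd_iff.1 dvd N h

theorem IsSolution.hasSum_coeff_succ [DecidableEq ι] [CommSemiring R] [TopologicalSpace R]
    {w : ι → (ι → ℕ) → R} {G : ι → R⟦X⟧} (hG : IsSolution w G) (i : ι) (N : ℕ) :
    HasSum (fun β => w i β * coeff N (∏ l, G l ^ β l)) (coeff (N + 1) (G i)) := by
  have disjoint : (range (N + 1) : Set ℕ).PairwiseDisjoint (piAntidiag (univ : Finset ι)) :=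
    fun a _ b _ hab => disjoint_left.2 fun β ha hb =>
      hab ((mem_piAntidiag.1 ha).1.symm.trans (mem_piAntidiag.1 hb).1)
  rw [hG.coeff_succ, ← sum_biUnion disjoint]
  refine hasSum_sum_of_ne_finset_zero fun β hβ => ?_
  rw [hG.coeff_prod_pow_eq_zero, mul_zero]
  by_contra! hlt
  exact hβ (mem_biUnion.2 ⟨∑ l, β l, by simpa using hlt, by simp⟩)

variable [NormedCommRing R] [CompleteSpace R] [NormOneClass R] {w : ι → (ι → ℕ) → R} {G : ι → R⟦X⟧}

theorem summable_mul_coeff_prod_pow {s : ℝ} (hs : ∀ i M, partialNorm M (G i) ≤ s) {v : (ι → ℕ) → R}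
    (hv : Summable fun β : ι → ℕ => ‖v β‖ * s ^ ∑ l, β l) :
    Summable fun p : (ι → ℕ) × ℕ => v p.1 * coeff p.2 (∏ l, G l ^ p.1 l) := by
  have partialNorm_le (β : ι → ℕ) (M : ℕ) : partialNorm M (∏ l, G l ^ β l) ≤ s ^ ∑ l, β l :=
    partialNorm_prod_pow_le (fun i => hs i M) β
  have summable_coeff (β : ι → ℕ) : Summable fun N => ‖coeff N (∏ l, G l ^ β l)‖ :=
    (hasAbsSum_tsum (partialNorm_le β)).summable
  refine Summable.of_norm_bounded (g := fun p => ‖v p.1‖ * ‖coeff p.2 (∏ l, G l ^ p.1 l)‖) ?_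
    fun p => norm_mul_le _ _
  refine (summable_prod_of_nonneg fun _ => by positivity).2
    ⟨fun β => (summable_coeff β).mul_left ‖v β‖, ?_⟩
  simp_rw [tsum_mul_left]
  refine Summable.of_nonneg_of_le (fun β => by positivity) (fun β => ?_) hv
  gcongr
  exact Real.tsum_le_of_sum_range_le (fun _ => norm_nonneg _) (partialNorm_le β)

/-- Sum the double family `w i β * coeff N (G ^ β)` first over `N` and first over `β`. -/
theorem IsSolution.hasSum [DecidableEq ι] (hG : IsSolution w G) {s : ℝ}
    (hs : ∀ i M, partialNorm M (G i) ≤ s)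
    (hw : ∀ i, Summable fun β : ι → ℕ => ‖w i β‖ * s ^ ∑ l, β l) {y : ι → R}
    (hy : ∀ i, HasAbsSum (G i) (y i)) (i : ι) :
    HasSum (fun β => w i β * ∏ l, y l ^ β l) (y i) := by
  have double := (summable_mul_coeff_prod_pow hs (hw i)).hasSum
  have over_N := double.prod_fiberwise fun β =>
    (HasAbsSum.prod fun l (_ : l ∈ univ) => (hy l).pow (β l)).hasSum.mul_left (w i β)
  have over_β := ((Equiv.prodComm _ _).hasSum_iff.2 double).prod_fiberwise (hG.hasSum_coeff_succ i)
  have shifted : HasSum (fun N => coeff (N + 1) (G i)) (y i) := by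
    simpa [hG.coeff_zero] using (hasSum_nat_add_iff' 1).2 (hy i).hasSum
  rwa [over_β.unique shifted] at over_N

end Evaluation

section Neumann

open Filter Topology

theorem summable_norm_pow_of_tendsto_zero {R : Type*} [SeminormedRing R] {a : R}
    (h : Tendsto (fun k => a ^ k) atTop (𝓝 0)) : Summable fun k => ‖a ^ k‖ := by
  obtain ⟨L, hL⟩ := (h.norm.eventually_le_const (by simp : ‖(0 : R)‖ < 1 / 2)).exists
  refine summable_of_sum_range_le (c := 2 * ∑ k ∈ range L, ‖a ^ k‖) (fun _ => norm_nonneg _)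
    fun M => ?_
  have initial_le : ∑ k ∈ range M, ‖a ^ k‖ ≤ ∑ k ∈ range (L + M), ‖a ^ k‖ :=
    sum_le_sum_of_subset_of_nonneg (range_subset_range.2 (Nat.le_add_left M L))
      fun _ _ _ => norm_nonneg _
  have tail_le : ∑ k ∈ range M, ‖a ^ (L + k)‖ ≤ 1 / 2 * ∑ k ∈ range M, ‖a ^ k‖ := by
    rw [mul_sum]
    gcongr with k
    rw [pow_add]
    exact (norm_mul_le _ _).trans (mul_le_mul_of_nonneg_right hL (norm_nonneg _))
  rw [sum_range_add] at initial_le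
  linarith

variable {n : ℕ} {A : Matrix (Fin n) (Fin n) ℂ}

theorem NeumannConverges.tendsto_pow (hA : NeumannConverges A) :
    Tendsto (fun k => A ^ k) atTop (𝓝 0) := by
  obtain ⟨S, hS⟩ := hA
  simpa [sum_range_succ] using ((tendsto_add_atTop_iff_nat 1).2 hS).sub hS

theorem NeumannConverges.isUnit (hA : NeumannConverges A) : IsUnit (1 - A) := by
  obtain ⟨S, hS⟩ := id hA
  have tendsto_one : Tendsto (fun K => (1 - A) * ∑ k ∈ range K, A ^ k) atTop (𝓝 1) := by
    simpa [mul_neg_geom_sum] using hA.tendsto_pow.const_sub 1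
  exact IsUnit.of_mul_eq_one S
    (tendsto_nhds_unique (hS.const_mul (1 - A)) tendsto_one)

open scoped Matrix.Norms.Operator in
theorem NeumannConverges.summable_norm_pow (hA : NeumannConverges A) :
    Summable fun k => ‖A ^ k‖ :=
  summable_norm_pow_of_tendsto_zero hA.tendsto_pow

end Neumann

end SeriesInversion

namespace SeriesInversion

open Finset
open MvPolynomial (monomial)

section WeightedNorm

variable {ι R : Type*} [SeminormedCommRing R]

/-- The `ℓ¹` norm of a polynomial on the polydisc of radius `r`: the sum of the norms of its
coefficients, weighted by powers of `r`.  It bounds the polynomial on that polydisc. -/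
noncomputable def weightedNorm (r : ℝ) (p : MvPolynomial ι R) : ℝ :=
  ∑ α ∈ p.support, ‖p.coeff α‖ * r ^ α.degree

theorem weightedNorm_eq_sum {r : ℝ} {p : MvPolynomial ι R} {S : Finset (ι →₀ ℕ)}
    (h : p.support ⊆ S) : weightedNorm r p = ∑ α ∈ S, ‖p.coeff α‖ * r ^ α.degree :=
  sum_subset h fun α _ hα => by
    rw [MvPolynomial.notMem_support_iff.1 hα, norm_zero, zero_mul]

theorem weightedNorm_monomial (r : ℝ) (α : ι →₀ ℕ) (c : R) :
    weightedNorm r (monomial α c) = ‖c‖ * r ^ α.degree := by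
  classical
  rw [weightedNorm_eq_sum MvPolynomial.support_monomial_subset, sum_singleton,
    MvPolynomial.coeff_monomial, if_pos rfl]

theorem weightedNorm_C (r : ℝ) (c : R) :
    weightedNorm r (MvPolynomial.C c : MvPolynomial ι R) = ‖c‖ := by
  rw [MvPolynomial.C_apply, weightedNorm_monomial, map_zero, pow_zero, mul_one]

theorem weightedNorm_X [NormOneClass R] (r : ℝ) (i : ι) :
    weightedNorm r (MvPolynomial.X i : MvPolynomial ι R) = r := by
  rw [MvPolynomial.X, weightedNorm_monomial, norm_one, Finsupp.degree_single, pow_one, one_mul]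

variable {r : ℝ}

theorem weightedNorm_nonneg (hr : 0 ≤ r) (p : MvPolynomial ι R) : 0 ≤ weightedNorm r p :=
  sum_nonneg fun _ _ => by positivity

theorem norm_coeff_mul_pow_le_weightedNorm (hr : 0 ≤ r) (p : MvPolynomial ι R) (α : ι →₀ ℕ) :
    ‖p.coeff α‖ * r ^ α.degree ≤ weightedNorm r p := by
  classical
  rw [weightedNorm_eq_sum (subset_insert α p.support)]
  exact single_le_sum (f := fun α => ‖p.coeff α‖ * r ^ α.degree) (fun _ _ => by positivity)
    (mem_insert_self _ _)

theorem weightedNorm_add_le (hr : 0 ≤ r) (p q : MvPolynomial ι R) :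
    weightedNorm r (p + q) ≤ weightedNorm r p + weightedNorm r q := by
  classical
  rw [weightedNorm_eq_sum (MvPolynomial.support_add (p := p) (q := q)),
    weightedNorm_eq_sum (p := p) subset_union_left,
    weightedNorm_eq_sum (p := q) subset_union_right, ← sum_add_distrib]
  gcongr with α
  rw [MvPolynomial.coeff_add, ← add_mul]
  gcongr
  exact norm_add_le _ _

theorem weightedNorm_sum_le (hr : 0 ≤ r) {κ : Type*} (t : Finset κ) (f : κ → MvPolynomial ι R) :
    weightedNorm r (∑ a ∈ t, f a) ≤ ∑ a ∈ t, weightedNorm r (f a) :=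
  le_sum_of_subadditive _ (by simp [weightedNorm]) (weightedNorm_add_le hr) t f

theorem weightedNorm_mul_le (hr : 0 ≤ r) (p q : MvPolynomial ι R) :
    weightedNorm r (p * q) ≤ weightedNorm r p * weightedNorm r q := by
  conv_lhs => rw [MvPolynomial.as_sum p, MvPolynomial.as_sum q, sum_mul_sum]
  refine (weightedNorm_sum_le hr _ _).trans ?_
  rw [weightedNorm, weightedNorm, sum_mul_sum]
  gcongr with α
  refine (weightedNorm_sum_le hr _ _).trans ?_
  gcongr with β
  rw [MvPolynomial.monomial_mul, weightedNorm_monomial, map_add, pow_add, mul_mul_mul_comm]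
  gcongr
  exact norm_mul_le _ _

/-- The weighted `ℓ¹` norm as a ring seminorm, which makes the general theory of seminormed rings
available for polynomials. -/
noncomputable def weightedSeminorm (ι R : Type*) [SeminormedCommRing R] (hr : 0 ≤ r) :
    RingSeminorm (MvPolynomial ι R) where
  toFun := weightedNorm r
  map_zero' := by simp [weightedNorm]
  add_le' := weightedNorm_add_le hr
  neg' p := by simp [weightedNorm, MvPolynomial.support_neg]
  mul_le' := weightedNorm_mul_le hr

/-- Polynomials as a seminormed ring for the weighted `ℓ¹` norm.  It is not an instance, as it
depends on the radius `r`. -/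
@[reducible]
noncomputable def weightedSeminormedCommRing (ι R : Type*) [SeminormedCommRing R] (hr : 0 ≤ r) :
    SeminormedCommRing (MvPolynomial ι R) where
  __ := (weightedSeminorm ι R hr).toSeminormedRing
  mul_comm := mul_comm

end WeightedNorm

section PolynomialSeries

variable {ι R : Type*} [NormedCommRing R] {r : ℝ}

section Evaluation

variable [NormOneClass R] {x : ι → R}

theorem norm_prod_pow_le (t : Finset ι) (hx : ∀ l, ‖x l‖ ≤ r) (α : ι → ℕ) :
    ‖∏ l ∈ t, x l ^ α l‖ ≤ r ^ ∑ l ∈ t, α l := by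
  rw [← prod_pow_eq_pow_sum]
  refine (Finset.norm_prod_le _ _).trans (prod_le_prod (fun _ _ => norm_nonneg _) fun l _ => ?_)
  exact (norm_pow_le _ _).trans (pow_le_pow_left₀ (norm_nonneg _) (hx l) _)

theorem norm_eval_le_weightedNorm (hx : ∀ l, ‖x l‖ ≤ r) (p : MvPolynomial ι R) :
    ‖MvPolynomial.eval x p‖ ≤ weightedNorm r p := by
  rw [MvPolynomial.eval_eq]
  exact norm_sum_le_of_le _ fun α _ => norm_mul_le_of_le le_rfl (norm_prod_pow_le _ hx α)

end Evaluation

variable [CompleteSpace R] {p : ℕ → MvPolynomial ι R}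

theorem summable_coeff_of_summable_weightedNorm (hr : 0 < r)
    (hp : Summable fun N => weightedNorm r (p N)) (α : ι →₀ ℕ) :
    Summable fun N => (p N).coeff α := by
  refine Summable.of_norm_bounded (hp.mul_left (r ^ α.degree)⁻¹) fun N => ?_
  rw [inv_mul_eq_div, le_div_iff₀ (by positivity)]
  exact norm_coeff_mul_pow_le_weightedNorm hr.le _ _

variable [NormOneClass R] [Fintype ι] {x : ι → R}

theorem summable_coeff_mul_prod_pow (hr : 0 ≤ r)
    (hp : Summable fun N => weightedNorm r (p N)) (hx : ∀ l, ‖x l‖ ≤ r) :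
    Summable fun q : ℕ × (ι →₀ ℕ) => (p q.1).coeff q.2 * ∏ l, x l ^ q.2 l := by
  have hasSum_weightedNorm (N : ℕ) :
      HasSum (fun α => ‖(p N).coeff α‖ * r ^ α.degree) (weightedNorm r (p N)) :=
    hasSum_sum_of_ne_finset_zero fun α hα => by
      rw [MvPolynomial.notMem_support_iff.1 hα, norm_zero, zero_mul]
  refine Summable.of_norm_bounded (g := fun q => ‖(p q.1).coeff q.2‖ * r ^ q.2.degree) ?_
    fun q => by
      rw [Finsupp.degree_eq_sum]
      exact norm_mul_le_of_le le_rfl (norm_prod_pow_le univ hx _)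
  refine (summable_prod_of_nonneg fun _ => by positivity).2
    ⟨fun N => (hasSum_weightedNorm N).summable, ?_⟩
  simpa only [(hasSum_weightedNorm _).tsum_eq] using hp

theorem hasSum_tsum_coeff_mul_prod_pow (hr : 0 < r)
    (hp : Summable fun N => weightedNorm r (p N)) (hx : ∀ l, ‖x l‖ ≤ r) :
    HasSum (fun α : ι →₀ ℕ => (∑' N, (p N).coeff α) * ∏ l, x l ^ α l)
      (∑' N, MvPolynomial.eval x (p N)) := by
  have double := (summable_coeff_mul_prod_pow hr.le hp hx).hasSum
  have hasSum_eval (N : ℕ) :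
      HasSum (fun α => (p N).coeff α * ∏ l, x l ^ α l) (MvPolynomial.eval x (p N)) := by
    rw [MvPolynomial.eval_eq']
    exact hasSum_sum_of_ne_finset_zero fun α hα => by
      rw [MvPolynomial.notMem_support_iff.1 hα, zero_mul]
  rw [(double.prod_fiberwise hasSum_eval).tsum_eq]
  exact ((Equiv.prodComm _ _).hasSum_iff.2 double).prod_fiberwise fun α =>
    (summable_coeff_of_summable_weightedNorm hr hp α).hasSum.mul_right _

end PolynomialSeries

section PolynomialSolution

open PowerSeries

open scoped Matrix.Norms.Operator

variable {ι R : Type*}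

/-- The coefficients of the right-hand side of the equation `G = t * (X + ∑ β ≠ 0, h β * G ^ β)`
over the ring of polynomials in the variables `X`. -/
noncomputable def inversionCoeff [CommSemiring R] (h : ι → (ι → ℕ) → R) (i : ι) (β : ι → ℕ) :
    MvPolynomial ι R :=
  open Classical in if β = 0 then MvPolynomial.X i else MvPolynomial.C (h i β)

theorem inversionCoeff_zero [CommSemiring R] (h : ι → (ι → ℕ) → R) (i : ι) :
    inversionCoeff h i 0 = MvPolynomial.X i := if_pos rfl

theorem inversionCoeff_of_ne_zero [CommSemiring R] (h : ι → (ι → ℕ) → R) (i : ι) {β : ι → ℕ}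
    (hβ : β ≠ 0) : inversionCoeff h i β = MvPolynomial.C (h i β) := if_neg hβ

variable [Fintype ι]

theorem norm_matrix_map_eq {R S : Type*} [SeminormedAddCommGroup R] [SeminormedAddCommGroup S]
    {f : R → S} (hf : ∀ a, ‖f a‖ = ‖a‖) (A : Matrix ι ι R) : ‖A.map f‖ = ‖A‖ := by
  have nnnorm_eq (a : R) : ‖f a‖₊ = ‖a‖₊ := NNReal.eq (hf a)
  simp_rw [Matrix.linfty_opNorm_def, Matrix.map_apply, nnnorm_eq]

theorem norm_pi_map_eq {R S : Type*} [SeminormedAddCommGroup R] [SeminormedAddCommGroup S]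
    {f : R → S} (hf : ∀ a, ‖f a‖ = ‖a‖) (v : ι → R) : ‖fun i => f (v i)‖ = ‖v‖ := by
  have nnnorm_eq (a : R) : ‖f a‖₊ = ‖a‖₊ := NNReal.eq (hf a)
  simp_rw [Pi.norm_def, nnnorm_eq]

variable [DecidableEq ι] [SeminormedCommRing R] [NormOneClass R]

theorem IsSolution.sum_weightedNorm_coeff_le {h : ι → (ι → ℕ) → R}
    {G : ι → (MvPolynomial ι R)⟦X⟧}
    (hG : IsSolution (inversionCoeff h) G) {C K r s ρ : ℝ} (hr : 0 ≤ r)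
    (hC : ∀ M, ∑ k ∈ range M, ‖(Matrix.of fun i j => h i (Pi.single j 1)) ^ k‖ ≤ C)
    (hK : ∀ M, ∑ m ∈ Ico 2 M, ∑ β ∈ piAntidiag univ m, ‖fun i => h i β‖ * ρ ^ m ≤ K)
    (hs : 0 ≤ s) (hρ : 0 < ρ) (hsρ : s ≤ ρ) (hle : C * (r + K * (s / ρ) ^ 2) ≤ s)
    (i : ι) (M : ℕ) : ∑ N ∈ range M, weightedNorm r (coeff N (G i)) ≤ s := by
  let _ := weightedSeminormedCommRing ι R hr
  have norm_C (c : R) : ‖(MvPolynomial.C c : MvPolynomial ι R)‖ = ‖c‖ := weightedNorm_C r c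
  have : NormOneClass (MvPolynomial ι R) := ⟨by rw [← MvPolynomial.C_1, norm_C, norm_one]⟩
  have linear_eq : (Matrix.of fun i j => inversionCoeff h i (Pi.single j 1))
      = (Matrix.of fun i j => h i (Pi.single j 1)).map MvPolynomial.C := by
    ext1 i j
    exact inversionCoeff_of_ne_zero h i (by simp)
  have norm_X_le : ‖fun i => inversionCoeff h i 0‖ ≤ r :=
    (pi_norm_le_iff_of_nonneg hr).2 fun i => by
      rw [inversionCoeff_zero]
      exact (weightedNorm_X r i).le
  have norm_inversionCoeff {m : ℕ} (hm : 2 ≤ m) {β : ι → ℕ} (hβ : β ∈ piAntidiag univ m) :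
      ‖fun i => inversionCoeff h i β‖ = ‖fun i => h i β‖ := by
    simp_rw [inversionCoeff_of_ne_zero h _ (ne_zero_of_mem_piAntidiag (by omega) hβ)]
    exact norm_pi_map_eq norm_C fun i => h i β
  refine (sum_le_sum fun N _ => norm_le_pi_norm (fun i => coeff N (G i)) i).trans
    (hG.sum_norm_coeff_le (C := C) (fun M => ?_) norm_X_le (fun M => ?_) hs hρ hsρ hle M)
  · simp_rw [linear_eq, ← RingHom.mapMatrix_apply, ← map_pow]
    simpa only [RingHom.mapMatrix_apply, norm_matrix_map_eq norm_C] using hC M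
  · refine (sum_congr rfl fun m hm => sum_congr rfl fun β hβ => ?_).trans_le (hK M)
    rw [norm_inversionCoeff (mem_Ico.1 hm).1 hβ]

end PolynomialSolution

end SeriesInversion

namespace SeriesInversion

open Finset Filter Topology

theorem hasSum_sum_piAntidiag {ι E : Type*} [Fintype ι] [DecidableEq ι] [AddCommMonoid E]
    [TopologicalSpace E] [ContinuousAdd E] [RegularSpace E] {f : (ι → ℕ) → E} {a : E}
    (hf : HasSum f a) : HasSum (fun m => ∑ β ∈ piAntidiag univ m, f β) a := by
  refine ((Equiv.sigmaFiberEquiv fun β : ι → ℕ => ∑ l, β l).hasSum_iff.2 hf).sigma fun m => ?_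
  let e : {β : ι → ℕ // ∑ l, β l = m} ≃ piAntidiag (univ : Finset ι) m :=
    Equiv.subtypeEquivRight fun β => by simp
  exact e.hasSum_iff.2 ((piAntidiag univ m).hasSum f)

section MonomialSeries

variable {𝕜 ι E : Type*} [NontriviallyNormedField 𝕜] [Fintype ι] [NormedAddCommGroup E]
  [NormedSpace 𝕜 E]

/-- The multilinear map `v ↦ ∏ k, v k (j k)`, whose diagonal is a monomial. -/
noncomputable def tupleMonomial (𝕜 : Type*) {ι : Type*} [NontriviallyNormedField 𝕜] {m : ℕ}
    (j : Fin m → ι) :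
    ContinuousMultilinearMap 𝕜 (fun _ : Fin m => ι → 𝕜) 𝕜 :=
  (ContinuousMultilinearMap.mkPiAlgebra 𝕜 (Fin m) 𝕜).compContinuousLinearMap
    fun k => ContinuousLinearMap.proj (j k)

theorem tupleMonomial_apply {ι : Type*} {m : ℕ} (j : Fin m → ι) (v : Fin m → ι → 𝕜) :
    tupleMonomial 𝕜 j v = ∏ k, v k (j k) := by
  simp [tupleMonomial]

theorem norm_tupleMonomial_le {m : ℕ} (j : Fin m → ι) : ‖tupleMonomial 𝕜 j‖ ≤ 1 := by
  refine ContinuousMultilinearMap.opNorm_le_bound zero_le_one fun v => ?_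
  rw [tupleMonomial_apply, norm_prod, one_mul]
  exact prod_le_prod (fun _ _ => norm_nonneg _) fun k _ => norm_le_pi_norm _ _

theorem summable_prod_pow_smul [CompleteSpace E] {c : (ι → ℕ) → E} {r : ℝ}
    (hc : Summable fun β => ‖c β‖ * r ^ ∑ l, β l) {x : ι → 𝕜} (hx : ∀ l, ‖x l‖ ≤ r) :
    Summable fun β => (∏ l, x l ^ β l) • c β := by
  refine Summable.of_norm_bounded hc fun β => ?_
  rw [norm_smul, mul_comm]
  gcongr
  exact norm_prod_pow_le univ hx β

variable [LinearOrder ι] {c : (ι → ℕ) → E}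

open Classical in
/-- The formal multilinear series of the power series `∑ β, x ^ β • c β`.  The monomial `x ^ β` is
polarized along the monotone tuple with fibre sizes `β`. -/
noncomputable def monomialSeries (𝕜 : Type*) [NontriviallyNormedField 𝕜] [NormedSpace 𝕜 E]
    (c : (ι → ℕ) → E) : FormalMultilinearSeries 𝕜 (ι → 𝕜) E :=
  fun m => ∑ j : Fin m → ι with Monotone j, (tupleMonomial 𝕜 j).smulRight (c (fiberCard j))

theorem monomialSeries_apply_diag (c : (ι → ℕ) → E) (m : ℕ) (x : ι → 𝕜) :
    monomialSeries 𝕜 c m (fun _ => x) = ∑ β ∈ piAntidiag univ m, (∏ l, x l ^ β l) • c β := by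
  rw [← sum_monotone_tuples, monomialSeries, _root_.sum_apply]
  simp_rw [ContinuousMultilinearMap.smulRight_apply, tupleMonomial_apply,
    prod_comp_eq_prod_pow_fiberCard]

theorem norm_monomialSeries_le (c : (ι → ℕ) → E) (m : ℕ) :
    ‖monomialSeries 𝕜 c m‖ ≤ ∑ β ∈ piAntidiag univ m, ‖c β‖ := by
  rw [← sum_monotone_tuples (fun β => ‖c β‖)]
  refine norm_sum_le_of_le _ fun j _ => ?_
  rw [ContinuousMultilinearMap.norm_smulRight]
  exact mul_le_of_le_one_left (norm_nonneg _) (norm_tupleMonomial_le j)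

variable [CompleteSpace E]

theorem hasFPowerSeriesOnBall_monomialSeries {r : NNReal} (hr : 0 < r)
    (hc : Summable fun β => ‖c β‖ * (r : ℝ) ^ ∑ l, β l) :
    HasFPowerSeriesOnBall (fun x : ι → 𝕜 => ∑' β, (∏ l, x l ^ β l) • c β) (monomialSeries 𝕜 c)
      0 r where
  r_le := by
    refine FormalMultilinearSeries.le_radius_of_bound _
      (∑' β, ‖c β‖ * (r : ℝ) ^ ∑ l, β l) fun m => ?_
    calc ‖monomialSeries 𝕜 c m‖ * (r : ℝ) ^ m
        ≤ (∑ β ∈ piAntidiag univ m, ‖c β‖) * (r : ℝ) ^ m := by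
          gcongr
          exact norm_monomialSeries_le c m
      _ = ∑ β ∈ piAntidiag univ m, ‖c β‖ * (r : ℝ) ^ ∑ l, β l := by
          rw [sum_mul]
          exact sum_congr rfl fun β hβ => by rw [(mem_piAntidiag.1 hβ).1]
      _ ≤ ∑' β, ‖c β‖ * (r : ℝ) ^ ∑ l, β l := hc.sum_le_tsum _ fun _ _ => by positivity
  r_pos := by simpa using hr
  hasSum {x} hx := by
    simp_rw [monomialSeries_apply_diag, zero_add]
    have norm_lt : ‖x‖ < r := by simpa using hx
    exact hasSum_sum_piAntidiag
      (summable_prod_pow_smul hc fun l => (norm_le_pi_norm x l).trans norm_lt.le).hasSum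

theorem hasStrictFDerivAt_tsum_prod_pow_smul {r : ℝ} (hr : 0 < r)
    (hc : Summable fun β => ‖c β‖ * r ^ ∑ l, β l) :
    HasStrictFDerivAt (fun x : ι → 𝕜 => ∑' β, (∏ l, x l ^ β l) • c β)
      (∑ j, (ContinuousLinearMap.proj (R := 𝕜) (φ := fun _ : ι => 𝕜) j).smulRight
        (c (Pi.single j 1))) 0 := by
  lift r to NNReal using hr.le
  refine (hasFPowerSeriesOnBall_monomialSeries (by exact_mod_cast hr)
    hc).hasFPowerSeriesAt.hasStrictFDerivAt.congr_fderiv ?_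
  ext1 x
  calc continuousMultilinearCurryFin1 𝕜 (ι → 𝕜) E (monomialSeries 𝕜 c 1) x
      = monomialSeries 𝕜 c 1 fun _ => x := by
        rw [continuousMultilinearCurryFin1_apply]
        congr 1
    _ = ∑ j, x j • c (Pi.single j 1) := by
        simp_rw [monomialSeries_apply_diag, sum_piAntidiag_one, Pi.single_apply, pow_ite, pow_one,
          pow_zero, prod_ite_eq' univ, mem_univ, if_true]
    _ = _ := by simp

theorem analyticOnNhd_tsum_prod_pow_smul {r : ℝ} (hc : Summable fun β => ‖c β‖ * r ^ ∑ l, β l) :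
    AnalyticOnNhd 𝕜 (fun x : ι → 𝕜 => ∑' β, (∏ l, x l ^ β l) • c β) (Metric.ball 0 r) := by
  intro x hx
  have hr : 0 < r := Metric.pos_of_mem_ball hx
  lift r to NNReal using hr.le
  exact (hasFPowerSeriesOnBall_monomialSeries (by exact_mod_cast hr) hc).analyticAt_of_mem
    (by simpa using hx)

end MonomialSeries

section LocalInverse

variable {𝕜 E F : Type*} [NontriviallyNormedField 𝕜] [NormedAddCommGroup E] [NormedSpace 𝕜 E]
  [CompleteSpace E] [NormedAddCommGroup F] [NormedSpace 𝕜 F]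

theorem exists_openPartialHomeomorph_of_rightInverse {f : E → F} {f' : E ≃L[𝕜] F} {a : E}
    (hf : HasStrictFDerivAt f (f' : E →L[𝕜] F) a) {y : F → E} (hy : ContinuousAt y (f a))
    (hya : y (f a) = a) {W : Set F} (hW : W ∈ 𝓝 (f a)) (hfy : ∀ x ∈ W, f (y x) = x) :
    ∃ e : OpenPartialHomeomorph E F,
      a ∈ e.source ∧ ⇑e = f ∧ e.target ⊆ W ∧ Set.EqOn e.symm y e.target := by
  set e₀ := hf.toOpenPartialHomeomorph f
  have mem_source : a ∈ e₀.source := hf.mem_toOpenPartialHomeomorph_source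
  have preimage_mem : y ⁻¹' e₀.source ∈ 𝓝 (f a) :=
    hy (e₀.open_source.mem_nhds (by rwa [hya]))
  obtain ⟨V, hV, V_open, mem_V⟩ := mem_nhds_iff.1 (inter_mem hW preimage_mem)
  set e := (e₀.symm.restrOpen V V_open).symm
  have target_subset : e.target ⊆ V := Set.inter_subset_right
  have symm_eq : Set.EqOn e.symm y V := fun x hx => by
    obtain ⟨hxW, hyx⟩ := hV hx
    calc e₀.symm x = e₀.symm (e₀ (y x)) := congrArg e₀.symm (hfy x hxW).symm
      _ = y x := e₀.left_inv hyx
  refine ⟨e, ?_, rfl, target_subset.trans (hV.trans Set.inter_subset_left),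
    symm_eq.mono target_subset⟩
  exact ⟨mem_source, Set.mem_preimage.2 mem_V⟩

end LocalInverse

end SeriesInversion

namespace SeriesInversion

open Finset Filter Topology PowerSeries

variable {n : ℕ} {h g : Fin n → (Fin n → ℕ) → ℂ} {U : Set (Fin n → ℂ)} {ρ r s : ℝ}

section SeriesMap

/-- The vector-valued coefficients of a family of power series, without the constant terms.  They
are those of `x - seriesMap h x`. -/
def nonconst (h : Fin n → (Fin n → ℕ) → ℂ) (β : Fin n → ℕ) : Fin n → ℂ :=
  if β = 0 then 0 else fun i => h i β

theorem hasSum_monom_smul_nonconst_iff {x a : Fin n → ℂ} :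
    HasSum (fun β => monom x β • nonconst h β) a ↔
      ∀ i, HasSum (fun α : {α : Fin n → ℕ // α ≠ 0} => h i α * monom x α) (a i) := by
  rw [Pi.hasSum]
  refine forall_congr' fun i => ?_
  rw [← (Subtype.val_injective (p := fun α : Fin n → ℕ => α ≠ 0)).hasSum_iff]
  · refine Eq.to_iff (congrArg (HasSum · (a i)) (funext fun α => ?_))
    simp [nonconst, α.2, mul_comm]
  · intro β hβ
    simp_all [nonconst]

theorem seriesMap_eq_sub_of_hasSum {x a : Fin n → ℂ}
    (ha : HasSum (fun β => monom x β • nonconst h β) a) : seriesMap h x = x - a :=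
  funext fun i => congrArg (x i - ·) (hasSum_monom_smul_nonconst_iff.1 ha i).tsum_eq

theorem summable_norm_nonconst_mul_pow (hρ : 0 ≤ ρ)
    (hs : Summable fun β => monom (fun _ => (ρ : ℂ)) β • nonconst h β) :
    Summable fun β => ‖nonconst h β‖ * ρ ^ ∑ l, β l := by
  refine hs.norm.congr fun β => ?_
  rw [norm_smul, monom, prod_pow_eq_pow_sum, norm_pow, Complex.norm_of_nonneg hρ, mul_comm]

theorem ConvergesOn.exists_summable_norm_nonconst (hconv : ConvergesOn h U) (hU : IsOpen U)
    (h0 : 0 ∈ U) : ∃ ρ > 0, Metric.closedBall 0 ρ ⊆ U ∧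
      Summable fun β => ‖nonconst h β‖ * ρ ^ ∑ l, β l := by
  obtain ⟨ρ, hρ, ball_subset⟩ := Metric.nhds_basis_closedBall.mem_iff.1 (hU.mem_nhds h0)
  refine ⟨ρ, hρ, ball_subset, summable_norm_nonconst_mul_pow hρ.le ?_⟩
  have mem_U : (fun _ => (ρ : ℂ)) ∈ U := ball_subset <| by
    rw [mem_closedBall_zero_iff]
    exact (pi_norm_le_iff_of_nonneg hρ.le).2 fun _ => (Complex.norm_of_nonneg hρ.le).le
  exact (hasSum_monom_smul_nonconst_iff (a := fun i => _).2
    fun i => (hconv _ mem_U i).hasSum).summable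

theorem seriesMap_eq_sub_tsum (hs : Summable fun β => ‖nonconst h β‖ * ρ ^ ∑ l, β l)
    {x : Fin n → ℂ} (hx : ‖x‖ ≤ ρ) : seriesMap h x = x - ∑' β, monom x β • nonconst h β :=
  seriesMap_eq_sub_of_hasSum
    (summable_prod_pow_smul hs fun l => (norm_le_pi_norm x l).trans hx).hasSum

theorem hasStrictFDerivAt_seriesMap (hρ : 0 < ρ)
    (hs : Summable fun β => ‖nonconst h β‖ * ρ ^ ∑ l, β l) :
    HasStrictFDerivAt (seriesMap h)
      (LinearMap.toContinuousLinearMap (Matrix.toLin' (1 - linearPart h))) 0 := by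
  have eventually_eq : (fun x => x - ∑' β, monom x β • nonconst h β) =ᶠ[𝓝 0] seriesMap h := by
    filter_upwards [Metric.closedBall_mem_nhds 0 hρ] with x hx
    exact (seriesMap_eq_sub_tsum hs (mem_closedBall_zero_iff.1 hx)).symm
  refine (((hasStrictFDerivAt_id 0).sub
    (hasStrictFDerivAt_tsum_prod_pow_smul hρ hs)).congr_of_eventuallyEq
      eventually_eq).congr_fderiv ?_
  ext x i
  simp [nonconst, linearPart, Matrix.mulVec, dotProduct, mul_comm]

theorem NeumannConverges.exists_hasStrictFDerivAt_seriesMap (hA : NeumannConverges (linearPart h))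
    (hρ : 0 < ρ) (hs : Summable fun β => ‖nonconst h β‖ * ρ ^ ∑ l, β l) :
    ∃ L : (Fin n → ℂ) ≃L[ℂ] Fin n → ℂ,
      HasStrictFDerivAt (seriesMap h) (L : (Fin n → ℂ) →L[ℂ] Fin n → ℂ) 0 :=
  have isUnit_det := (Matrix.isUnit_iff_isUnit_det _).1 hA.isUnit
  ⟨(Matrix.toLinearEquiv' _
    (Matrix.invertibleOfIsUnitDet _ isUnit_det)).toContinuousLinearEquiv,
    hasStrictFDerivAt_seriesMap hρ hs⟩

theorem hasAnalyticInverse_of_rightInverse {F y : (Fin n → ℂ) → Fin n → ℂ}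
    {L : (Fin n → ℂ) ≃L[ℂ] Fin n → ℂ}
    (hF : HasStrictFDerivAt F (L : (Fin n → ℂ) →L[ℂ] Fin n → ℂ) 0) (hr : 0 < r)
    (hy0 : y 0 = 0) (hyU : ∀ x, ‖x‖ ≤ r → y x ∈ U) (hFy : ∀ x, ‖x‖ ≤ r → F (y x) = x)
    (hy : ∀ x, ‖x‖ ≤ r → HasSum (fun β => monom x β • nonconst g β) (y x)) :
    HasAnalyticInverse F U g := by
  have norm_le {x : Fin n → ℂ} (hx : x ∈ Metric.ball 0 r) : ‖x‖ ≤ r :=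
    (mem_ball_zero_iff.1 hx).le
  have summable : Summable fun β => ‖nonconst g β‖ * r ^ ∑ l, β l :=
    summable_norm_nonconst_mul_pow hr.le <| (hy _ <|
      (pi_norm_le_iff_of_nonneg hr.le).2 fun _ => (Complex.norm_of_nonneg hr.le).le).summable
  have analytic : AnalyticOnNhd ℂ y (Metric.ball 0 r) :=
    (analyticOnNhd_tsum_prod_pow_smul summable).congr Metric.isOpen_ball
      fun x hx => (hy x (norm_le hx)).tsum_eq
  have F_zero : F 0 = 0 := by simpa only [hy0] using hFy 0 (by simpa using hr.le)
  have ball_mem : Metric.ball 0 r ∈ 𝓝 (F 0) := by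
    rw [F_zero]
    exact Metric.ball_mem_nhds 0 hr
  obtain ⟨e, zero_mem, rfl, target_subset, symm_eq⟩ :=
    exists_openPartialHomeomorph_of_rightInverse hF
      (analytic.continuousOn.continuousAt ball_mem) (by rw [F_zero, hy0]) ball_mem
      fun x hx => hFy x (norm_le hx)
  refine ⟨e, zero_mem, fun u hu => ?_, fun _ _ => rfl, F_zero, ?_, fun x hx => ?_⟩
  · have mem_target := e.map_source hu
    rw [← e.left_inv hu, symm_eq mem_target]
    exact hyU _ (norm_le (target_subset mem_target))
  · exact (analytic.mono target_subset).congr e.open_target symm_eq.symm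
  · rw [symm_eq hx]
    exact hasSum_monom_smul_nonconst_iff.1 (hy x (norm_le (target_subset hx)))

end SeriesMap

section PolynomialSolution

variable {G : Fin n → (MvPolynomial (Fin n) ℂ)⟦X⟧}

/-- The value at `t = 1` of series in `t` whose coefficients are evaluated at `x`. -/
noncomputable def evalSum (G : Fin n → (MvPolynomial (Fin n) ℂ)⟦X⟧) (x : Fin n → ℂ) : Fin n → ℂ :=
  fun i => ∑' N, MvPolynomial.eval x (coeff N (G i))

/-- The coefficient of `X ^ α` in the value at `t = 1` of series in `t` with polynomial
coefficients. -/
noncomputable def coeffSum (G : Fin n → (MvPolynomial (Fin n) ℂ)⟦X⟧) (i : Fin n)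
    (α : Fin n → ℕ) : ℂ :=
  ∑' N, (coeff N (G i)).coeff (Finsupp.equivFunOnFinite.symm α)

theorem IsSolution.constantCoeff_coeff (hG : IsSolution (inversionCoeff h) G) (i : Fin n) (N : ℕ) :
    MvPolynomial.constantCoeff (coeff N (G i)) = 0 := by
  have map_eq_zero := (hG.map MvPolynomial.constantCoeff).eq_zero
    (fun i => by rw [inversionCoeff_zero, MvPolynomial.constantCoeff_X]) i
  rw [← coeff_map, map_eq_zero, map_zero]

theorem IsSolution.evalSum_zero (hG : IsSolution (inversionCoeff h) G) : evalSum G 0 = 0 := by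
  funext i
  simp_rw [evalSum, MvPolynomial.eval_zero, hG.constantCoeff_coeff]
  exact tsum_zero

theorem IsSolution.nonconst_coeffSum (hG : IsSolution (inversionCoeff h) G) :
    nonconst (coeffSum G) = fun α i => coeffSum G i α := by
  funext α i
  obtain rfl | hα := eq_or_ne α 0
  · have symm_zero : Finsupp.equivFunOnFinite.symm (0 : Fin n → ℕ) = 0 :=
      Finsupp.ext fun _ => rfl
    simp_rw [nonconst, if_pos, coeffSum, symm_zero, ← MvPolynomial.constantCoeff_eq,
      hG.constantCoeff_coeff, tsum_zero, Pi.zero_apply]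
  · rw [nonconst, if_neg hα]

variable {x : Fin n → ℂ}

theorem summable_weightedNorm_coeff (hr : 0 ≤ r)
    (hsum : ∀ i M, ∑ N ∈ range M, weightedNorm r (coeff N (G i)) ≤ s) (i : Fin n) :
    Summable fun N => weightedNorm r (coeff N (G i)) :=
  summable_of_sum_range_le (fun _ => weightedNorm_nonneg hr _) (hsum i)

theorem partialNorm_map_eval_le
    (hsum : ∀ i M, ∑ N ∈ range M, weightedNorm r (coeff N (G i)) ≤ s) (hx : ‖x‖ ≤ r)
    (i : Fin n) (M : ℕ) : partialNorm M (PowerSeries.map (MvPolynomial.eval x) (G i)) ≤ s := by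
  refine le_trans (sum_le_sum fun N _ => ?_) (hsum i M)
  rw [coeff_map]
  exact norm_eval_le_weightedNorm (fun l => (norm_le_pi_norm x l).trans hx) _

theorem hasAbsSum_evalSum
    (hsum : ∀ i M, ∑ N ∈ range M, weightedNorm r (coeff N (G i)) ≤ s) (hx : ‖x‖ ≤ r)
    (i : Fin n) : HasAbsSum (PowerSeries.map (MvPolynomial.eval x) (G i)) (evalSum G x i) := by
  simp_rw [evalSum, ← coeff_map]
  exact hasAbsSum_tsum (partialNorm_map_eval_le hsum hx i)

theorem norm_evalSum_le (hs : 0 ≤ s)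
    (hsum : ∀ i M, ∑ N ∈ range M, weightedNorm r (coeff N (G i)) ≤ s) (hx : ‖x‖ ≤ r) :
    ‖evalSum G x‖ ≤ s := by
  refine (pi_norm_le_iff_of_nonneg hs).2 fun i => ?_
  have h := hasAbsSum_evalSum hsum hx i
  rw [← h.hasSum.tsum_eq]
  exact (norm_tsum_le_tsum_norm h.summable).trans
    (Real.tsum_le_of_sum_range_le (fun _ => norm_nonneg _) (partialNorm_map_eval_le hsum hx i))

theorem IsSolution.hasSum_monom_smul_coeffSum (hG : IsSolution (inversionCoeff h) G) (hr : 0 < r)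
    (hsum : ∀ i M, ∑ N ∈ range M, weightedNorm r (coeff N (G i)) ≤ s) (hx : ‖x‖ ≤ r) :
    HasSum (fun α => monom x α • nonconst (coeffSum G) α) (evalSum G x) := by
  rw [hG.nonconst_coeffSum]
  refine Pi.hasSum.2 fun i => Finsupp.equivFunOnFinite.hasSum_iff.1 ?_
  refine (hasSum_tsum_coeff_mul_prod_pow hr (summable_weightedNorm_coeff hr.le hsum i)
    fun l => (norm_le_pi_norm x l).trans hx).congr_fun fun α => ?_
  simp [coeffSum, monom, mul_comm]

theorem summable_norm_eval_inversionCoeff (hs : 0 ≤ s) (hsρ : s ≤ ρ)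
    (hρs : Summable fun β => ‖nonconst h β‖ * ρ ^ ∑ l, β l) (x : Fin n → ℂ) (i : Fin n) :
    Summable fun β => ‖MvPolynomial.eval x (inversionCoeff h i β)‖ * s ^ ∑ l, β l := by
  refine Summable.of_norm_bounded_eventually hρs ?_
  filter_upwards [eventually_cofinite_ne 0] with β hβ
  have norm_le : ‖h i β‖ ≤ ‖nonconst h β‖ := by
    rw [nonconst, if_neg hβ]
    exact norm_le_pi_norm (fun i => h i β) i
  rw [inversionCoeff_of_ne_zero h i hβ, MvPolynomial.eval_C, Real.norm_of_nonneg (by positivity)]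
  gcongr

theorem IsSolution.seriesMap_evalSum (hG : IsSolution (inversionCoeff h) G) (hs : 0 ≤ s)
    (hsρ : s ≤ ρ) (hρs : Summable fun β => ‖nonconst h β‖ * ρ ^ ∑ l, β l)
    (hsum : ∀ i M, ∑ N ∈ range M, weightedNorm r (coeff N (G i)) ≤ s) (hx : ‖x‖ ≤ r) :
    seriesMap h (evalSum G x) = x := by
  have fixed_point (i : Fin n) : HasSum
      (fun β => MvPolynomial.eval x (inversionCoeff h i β) * monom (evalSum G x) β)
      (evalSum G x i) :=
    (hG.map (MvPolynomial.eval x)).hasSum (partialNorm_map_eval_le hsum hx)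
      (summable_norm_eval_inversionCoeff hs hsρ hρs x) (hasAbsSum_evalSum hsum hx) i
  have sub_fixed_point :
      HasSum (fun β => monom (evalSum G x) β • nonconst h β) (evalSum G x - x) := by
    refine Pi.hasSum.2 fun i =>
      ((fixed_point i).sub (hasSum_ite_eq 0 (x i))).congr_fun fun β => ?_
    obtain rfl | hβ := eq_or_ne β 0
    · simp [nonconst, inversionCoeff_zero, monom]
    · simp [nonconst, inversionCoeff_of_ne_zero, hβ, mul_comm]
  rw [seriesMap_eq_sub_of_hasSum sub_fixed_point, sub_sub_cancel]

theorem sum_Ico_norm_mul_pow_le (hρ : 0 ≤ ρ)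
    (hρs : Summable fun β => ‖nonconst h β‖ * ρ ^ ∑ l, β l) (M : ℕ) :
    ∑ m ∈ Ico 2 M, ∑ β ∈ piAntidiag univ m, ‖fun i => h i β‖ * ρ ^ m
      ≤ ∑' β, ‖nonconst h β‖ * ρ ^ ∑ l, β l := by
  refine le_trans (le_of_eq ?_)
    (sum_le_hasSum (Ico 2 M) (fun _ _ => sum_nonneg fun _ _ => by positivity)
      (hasSum_sum_piAntidiag hρs.hasSum))
  refine sum_congr rfl fun m hm => sum_congr rfl fun β hβ => ?_
  have two_le : 2 ≤ m := (mem_Ico.1 hm).1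
  rw [(mem_piAntidiag.1 hβ).1, nonconst, if_neg (ne_zero_of_mem_piAntidiag (by omega) hβ)]

open scoped Matrix.Norms.Operator in
theorem IsSolution.exists_sum_weightedNorm_le (hG : IsSolution (inversionCoeff h) G)
    (hA : NeumannConverges (linearPart h)) (hρ : 0 < ρ)
    (hρs : Summable fun β => ‖nonconst h β‖ * ρ ^ ∑ l, β l) :
    ∃ r s, 0 < r ∧ 0 ≤ s ∧ s ≤ ρ ∧
      ∀ i M, ∑ N ∈ range M, weightedNorm r (coeff N (G i)) ≤ s := by
  have le_C (M : ℕ) : ∑ k ∈ range M, ‖linearPart h ^ k‖ ≤ ∑' k, ‖linearPart h ^ k‖ :=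
    hA.summable_norm_pow.sum_le_tsum _ fun _ _ => norm_nonneg _
  have le_K := sum_Ico_norm_mul_pow_le hρ.le hρs
  obtain ⟨r, s, hr, hs, hsρ, hle⟩ := exists_radii
    (tsum_nonneg fun k => norm_nonneg (linearPart h ^ k))
    (tsum_nonneg fun β => show 0 ≤ ‖nonconst h β‖ * ρ ^ ∑ l, β l by positivity) hρ
  exact ⟨r, s, hr, hs.le, hsρ,
    fun i => hG.sum_weightedNorm_coeff_le hr.le le_C le_K hs.le hρ hsρ hle i⟩

theorem IsSolution.hasAnalyticInverse (hG : IsSolution (inversionCoeff h) G) (hU : IsOpen U)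
    (h0 : 0 ∈ U) (hconv : ConvergesOn h U) (hA : NeumannConverges (linearPart h)) :
    (∀ i α, Summable fun N => (coeff N (G i)).coeff α) ∧
      HasAnalyticInverse (seriesMap h) U (coeffSum G) := by
  obtain ⟨ρ, hρ, closedBall_subset, hρs⟩ := hconv.exists_summable_norm_nonconst hU h0
  obtain ⟨r, s, hr, hs, hsρ, hsum⟩ := hG.exists_sum_weightedNorm_le hA hρ hρs
  obtain ⟨L, hL⟩ := hA.exists_hasStrictFDerivAt_seriesMap hρ hρs
  refine ⟨fun i => summable_coeff_of_summable_weightedNorm hr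
      (summable_weightedNorm_coeff hr.le hsum i),
    hasAnalyticInverse_of_rightInverse hL hr hG.evalSum_zero (fun x hx => closedBall_subset ?_)
      (fun x => hG.seriesMap_evalSum hs hsρ hρs hsum)
      fun x => hG.hasSum_monom_smul_coeffSum hr hsum⟩
  exact mem_closedBall_zero_iff.2 ((norm_evalSum_le hs hsum hx).trans hsρ)

end PolynomialSolution

end SeriesInversion

namespace SeriesInversion

open Finset

theorem div_multiFactorial_eq {n : ℕ} (β : Fin n → ℕ) (z : ℂ) :
    z / multiFactorial β = Nat.multinomial univ β * (z / (∑ l, β l).factorial) := by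
  have multinomial_spec : (multiFactorial β : ℂ) * Nat.multinomial univ β
      = (∑ l, β l).factorial := by exact_mod_cast Nat.multinomial_spec univ β
  have factorial_ne : ((∑ l, β l).factorial : ℂ) ≠ 0 := Nat.cast_ne_zero.2 (Nat.factorial_ne_zero _)
  rw [← multinomial_spec] at factorial_ne ⊢
  have := left_ne_zero_of_mul factorial_ne
  have := right_ne_zero_of_mul factorial_ne
  field_simp

end SeriesInversion

namespace TypedTree

open Finset PowerSeries SeriesInversion

variable {n : ℕ} {Q : ∀ m, (Fin m → Fin n) → Prop}

/-- The types of the children of every vertex, listed from left to right, satisfy `Q`. -/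
def AllSiblings (Q : ∀ m, (Fin m → Fin n) → Prop) : TypedTree n → Prop
  | node _ m c => Q m (fun k => (c k).rootType) ∧ ∀ k, (c k).AllSiblings Q

/-- The trees with root type `i` and leaf type `α` whose sibling types satisfy `Q`. -/
def siblingTrees (Q : ∀ m, (Fin m → Fin n) → Prop) (i : Fin n) (α : Fin n → ℕ) :
    Set (TypedTree n) :=
  {T | T.AllSiblings Q ∧ T.rootType = i ∧ T.leafType = α}

theorem allSiblings_monotone_iff (T : TypedTree n) :
    T.AllSiblings (fun _ j => Monotone j) ↔ T.IsOrdered := by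
  induction T with
  | node t m c ih => simp_rw [AllSiblings, IsOrdered, ih]

theorem allSiblings_of_forall (hQ : ∀ m j, Q m j) (T : TypedTree n) : T.AllSiblings Q := by
  induction T with
  | node _ _ _ ih => exact ⟨hQ _ _, ih⟩

theorem orderedTrees_eq_siblingTrees (i : Fin n) (α : Fin n → ℕ) :
    orderedTrees i α = siblingTrees (fun _ j => Monotone j) i α := by
  simp_rw [orderedTrees, siblingTrees, allSiblings_monotone_iff]

theorem unorderedTrees_eq_siblingTrees (i : Fin n) (α : Fin n → ℕ) :
    unorderedTrees i α = siblingTrees (fun _ _ => True) i α := by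
  simp_rw [unorderedTrees, siblingTrees, allSiblings_of_forall fun _ _ => trivial, true_and]

variable {R : Type*} [CommSemiring R] [∀ m, DecidablePred (Q m)]

/-- Vertex weights for counting the trees with `AllSiblings Q`: a leaf of type `i` has weight
`X i`, and an internal vertex the weight given by `w`. -/
noncomputable def siblingWeight (Q : ∀ m, (Fin m → Fin n) → Prop) [∀ m, DecidablePred (Q m)]
    (w : Fin n → (Fin n → ℕ) → R) (i : Fin n) (m : ℕ) (j : Fin m → Fin n) :
    MvPolynomial (Fin n) R :=
  if Q m j then inversionCoeff w i (fiberCard j) else 0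

theorem isSolution_treeSeries_siblingWeight {w : Fin n → (Fin n → ℕ) → R} {ν : (Fin n → ℕ) → ℕ}
    (hν : ∀ m, ∀ β ∈ piAntidiag univ m, #{j : Fin m → Fin n | fiberCard j = β ∧ Q m j} = ν β)
    (hν₀ : ν 0 = 1) :
    IsSolution (inversionCoeff fun i β => ν β * w i β) (treeSeries (siblingWeight Q w)) := by
  refine isSolution_treeSeries fun i m β hβ => ?_
  calc ∑ j : Fin m → Fin n with fiberCard j = β, siblingWeight Q w i m j
      = ∑ j : Fin m → Fin n with fiberCard j = β,
          if Q m j then inversionCoeff w i β else 0 :=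
        sum_congr rfl fun j hj => by rw [siblingWeight, (mem_filter.1 hj).2]
    _ = ν β * inversionCoeff w i β := by
        rw [← sum_filter, filter_filter, sum_const, hν m β hβ, nsmul_eq_mul]
    _ = inversionCoeff (fun i β => ν β * w i β) i β := by
        obtain rfl | hβ₀ := eq_or_ne β 0
        · simp [inversionCoeff_zero, hν₀]
        · simp [inversionCoeff_of_ne_zero, hβ₀]

theorem inversionCoeff_childType_mul_monomial (w : Fin n → (Fin n → ℕ) → ℂ) (t : Fin n) {m : ℕ}
    (c : Fin m → TypedTree n) :
    inversionCoeff w t (childType c) * MvPolynomial.monomial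
        (∑ k, Finsupp.equivFunOnFinite.symm (c k).leafType) (∏ k, (c k).weight w)
      = MvPolynomial.monomial (Finsupp.equivFunOnFinite.symm (node t m c).leafType)
        ((node t m c).weight w) := by
  have sum_childType : ∑ l, childType c l = m :=
    (sum_fiberCard fun k => (c k).rootType).trans (Fintype.card_fin m)
  rw [leafType, weight]
  obtain rfl | hm := eq_or_ne m 0
  · have childType_eq : childType c = 0 := by simpa [funext_iff] using sum_childType
    simp [childType_eq, inversionCoeff_zero, MvPolynomial.X]
  · have childType_ne : childType c ≠ 0 := by
      intro childType_eq
      simp [childType_eq, hm.symm] at sum_childType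
    have sum_leafType : ∑ k, Finsupp.equivFunOnFinite.symm (c k).leafType
        = Finsupp.equivFunOnFinite.symm (∑ k, (c k).leafType) := by
      ext l
      simp
    rw [if_neg hm, if_neg hm, inversionCoeff_of_ne_zero w t childType_ne,
      MvPolynomial.C_mul_monomial, sum_leafType]

theorem AllSiblings.vertexProd_siblingWeight {T : TypedTree n} (hT : T.AllSiblings Q)
    (w : Fin n → (Fin n → ℕ) → ℂ) : T.vertexProd (siblingWeight Q w) =
      MvPolynomial.monomial (Finsupp.equivFunOnFinite.symm T.leafType) (T.weight w) := by
  induction T with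
  | node t m c ih =>
    rw [vertexProd, siblingWeight, if_pos hT.1, prod_congr rfl fun k _ => ih k (hT.2 k),
      ← MvPolynomial.monomial_sum_prod]
    exact inversionCoeff_childType_mul_monomial w t c

theorem vertexProd_siblingWeight_of_not_allSiblings {T : TypedTree n} (hT : ¬ T.AllSiblings Q)
    (w : Fin n → (Fin n → ℕ) → R) : T.vertexProd (siblingWeight Q w) = 0 := by
  induction T with
  | node t m c ih =>
    rw [vertexProd, siblingWeight]
    split_ifs with hQ
    · obtain ⟨k, hk⟩ := not_forall.1 fun hc => hT ⟨hQ, hc⟩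
      rw [prod_eq_zero (mem_univ k) (ih k hk), mul_zero]
    · rw [zero_mul]

open Classical in
theorem coeff_coeff_treeSeries_siblingWeight (w : Fin n → (Fin n → ℕ) → ℂ) (i : Fin n)
    (α : Fin n → ℕ) (N : ℕ) :
    (coeff N (treeSeries (siblingWeight Q w) i)).coeff (Finsupp.equivFunOnFinite.symm α)
      = ∑ T ∈ ofSize n N with T ∈ siblingTrees Q i α, T.weight w := by
  simp_rw [coeff_treeSeries, MvPolynomial.coeff_sum, sum_filter, siblingTrees, Set.mem_ofPred_eq]
  refine sum_congr rfl fun T _ => ?_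
  by_cases hT : T.AllSiblings Q
  · simp [hT, hT.vertexProd_siblingWeight, MvPolynomial.coeff_monomial, ite_and]
  · simp [hT, vertexProd_siblingWeight_of_not_allSiblings]

theorem exists_hasTreeSum_hasAnalyticInverse {h w : Fin n → (Fin n → ℕ) → ℂ}
    {ν : (Fin n → ℕ) → ℕ}
    (hν : ∀ m, ∀ β ∈ piAntidiag univ m, #{j : Fin m → Fin n | fiberCard j = β ∧ Q m j} = ν β)
    (hν₀ : ν 0 = 1) (hw : ∀ i β, h i β = ν β * w i β) {U : Set (Fin n → ℂ)} (hU : IsOpen U)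
    (h0 : 0 ∈ U) (hconv : ConvergesOn h U) (hA : NeumannConverges (linearPart h)) :
    ∃ g : Fin n → (Fin n → ℕ) → ℂ,
      (∀ i α, HasTreeSum (siblingTrees Q i α) w (g i α)) ∧
      HasAnalyticInverse (seriesMap h) U g := by
  obtain rfl : h = fun i β => ν β * w i β := funext₂ hw
  have isSolution := isSolution_treeSeries_siblingWeight (w := w) hν hν₀
  obtain ⟨summable, hasAnalyticInverse⟩ := isSolution.hasAnalyticInverse hU h0 hconv hA
  refine ⟨_, fun i α => ?_, hasAnalyticInverse⟩
  exact (summable i _).hasSum.congr_fun fun N =>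
    (coeff_coeff_treeSeries_siblingWeight w i α N).symm

end TypedTree

theorem theorem2p1 :
    -- coefficients `h`, ordered trees
    (∀ (n : ℕ) (h : Fin n → (Fin n → ℕ) → ℂ) (U : Set (Fin n → ℂ)),
      IsOpen U → (0 : Fin n → ℂ) ∈ U → SeriesInversion.ConvergesOn h U →
      SeriesInversion.NeumannConverges (SeriesInversion.linearPart h) →
      ∃ g : Fin n → (Fin n → ℕ) → ℂ,
        (∀ i α, TypedTree.HasTreeSum (TypedTree.orderedTrees i α) h (g i α)) ∧
        SeriesInversion.HasAnalyticInverse (SeriesInversion.seriesMap h) U g) ∧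
    -- coefficients `H / α!`, unordered trees
    (∀ (n : ℕ) (H h : Fin n → (Fin n → ℕ) → ℂ) (U : Set (Fin n → ℂ)),
      (∀ i α, h i α = H i α / (SeriesInversion.multiFactorial α : ℂ)) →
      IsOpen U → (0 : Fin n → ℂ) ∈ U → SeriesInversion.ConvergesOn h U →
      SeriesInversion.NeumannConverges (SeriesInversion.linearPart h) →
      ∃ g : Fin n → (Fin n → ℕ) → ℂ,
        (∀ i α, TypedTree.HasTreeSum (TypedTree.unorderedTrees i α)
          (fun j β => H j β / ((∑ l, β l).factorial : ℂ)) (g i α)) ∧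
        SeriesInversion.HasAnalyticInverse (SeriesInversion.seriesMap h) U g) := by
  classical
  open TypedTree SeriesInversion in
  constructor
  · intro n h U hU h0 hconv hA
    simp_rw [orderedTrees_eq_siblingTrees]
    exact exists_hasTreeSum_hasAnalyticInverse
      (ν := 1) (fun m β hβ => card_filter_fiberCard_eq_and_monotone hβ) rfl (by simp)
      hU h0 hconv hA
  · intro n H h U hh hU h0 hconv hA
    simp_rw [unorderedTrees_eq_siblingTrees]
    exact exists_hasTreeSum_hasAnalyticInverse (ν := Nat.multinomial Finset.univ)
      (fun m β hβ => by simpa using card_filter_fiberCard_eq hβ) (by simp [Nat.multinomial])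
      (fun i β => by rw [hh, div_multiFactorial_eq]) hU h0 hconv hA
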